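/- **Setting.** Let $\mathbb X$ be a complete separable metric space and $\mathbb U$ a finite nonempty (discrete) action set. Let $\mathcal T(\cdot\mid x,u)$ be a weakly continuous controlled transition kernel on $\mathbb X$ and $c:\mathbb X\times\mathbb U\to[0,\infty)$ a continuous cost bounded by $\|c\|_\infty$. Assume $|c(x,u)-c(y,u)|\le \|c\|_{\rm Lip}\,d(x,y)$ and $\mathcal W_1(\mathcal T(\cdot|x,u),\mathcal T(\cdot|y,u))\le \|\mathcal T\|_{\rm Lip}\,d(x,y)$ for all $x,y,u$, where $\|\mathcal T\|_{\rm Lip}<1$ and $\mathcal W_1$ is the Wasserstein-1 distance. Assume the minorization condition: there are a probability measure $\rho$ on $\mathbb X$ and $\epsilon>0$ with $\mathcal T(A|x,u)\ge\epsilon\rho(A)$ for all $x,u$ and measurable $A$. For a policy $\gamma$ (possibly randomized and history dependent) let $J_\infty(c,\mathcal T,\gamma)(x)=\limsup_{n\to\infty}\frac1n\mathbb E^{\mathcal T,\gamma}\big[\sum_{t<n}c(X_t,U_t)\mid X_0=x\big]$, and let $J^*_\infty(c,\mathcal T)(x)$ be its infimum over all such policies. **Data.** Let $\gamma$ be a probability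 on $\mathbb U$ with $\gamma_u>0$ for every $u$, and let $(X_n,U_n)_{n\ge0}$ be a Markov chain with $\mathbb P(X_{n+1}\in A,\,U_{n+1}=u'\mid X_n=x,U_n=u)=\gamma_{u'}\mathcal T(A|x,u)$. Assume that (a) the chain $Z_n=(X_n,U_n,X_{n+1})$ is $\psi$-irreducible and has a unique invariant probability $\tilde\pi$; it has the form $\tilde\pi(A\times\{u\}\times A')=\int_A\mathcal T(A'|x,u)\gamma_u\,\pi(dx)$ for a probability measure $\pi$ on $\mathbb X$; (b) for some constants $C_0,c_0>0$, every measurable $f:\mathbb X\times\mathbb U\times\mathbb X\to[0,1]$, $\eta>0$ and $n\ge1$, $$\mathbb P\Big(\Big|\tfrac1n\sum_{t=0}^{n-1}f(X_t,U_t,X_{t+1})-\int f\,d\tilde\pi\Big|\ge\eta\Big)\le C_0e^{-c_0n\eta^2}.$$ **Learned model.** Let $\{B_i\}_{i=1}^M$ be a measurable partition of $\mathbb X$ with $\pi(B_i)>0$ for all $i$, and let $\delta_M=\max_i\operatorname{diam}B_i$. Put $\mathcal T^{\pi,M}(j|i,u)=\pi(B_i)^{-1}\int_{B_i}\mathcal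 T(B_j|x,u)\,\pi(dx)$, $\kappa_{\pi,M}=\min_{i,u}\gamma_u\pi(B_i)$, and let $\kappa_{\mathcal T,M}$ be the smallest nonzero entry of $\mathcal T^{\pi,M}$. For $N\ge1$, with $n_{i,u}=\#\{n<N:X_n\in B_i,U_n=u\}$, put $$\hat{\mathcal T}_N(j|i,u)=\frac{\#\{n<N:X_n\in B_i,U_n=u,X_{n+1}\in B_j\}}{n_{i,u}},\qquad \hat c_N(i,u)=\frac{\sum_{n<N}c(X_n,U_n)\mathbf 1\{X_n\in B_i,U_n=u\}}{n_{i,u}},$$ with the convention $\hat{\mathcal T}_N(j|i,u)=\mathbf 1\{j=i\}$, $\hat c_N(i,u)=0$ when $n_{i,u}=0$. Let $\hat\gamma_{N}$ be a (measurably selected) deterministic stationary policy which is average-cost optimal, from every state, for the finite model $([M],\mathbb U,\hat{\mathcal T}_N,\hat c_N)$, and let $\overline{\hat\gamma_N}(x)=\hat\gamma_N(i)$ for $x\in B_i$. **Theorem.** There is a constant $C>0$, depending only on $C_0,c_0,\|c\|_{\rm Lip},\|\mathcal T\|_{\rm Lip},\|c\|_\infty,\epsilon$, such that $$\mathbb E\Big[\big\|J_\infty(c,\mathcal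 T,\overline{\hat\gamma_N})-J^*_\infty(c,\mathcal T)\big\|_\infty\Big]\le C\Big(\delta_M+\frac1{\kappa_{\pi,M}}\sqrt{\frac{\log(M|\mathbb U|)}{N}}\Big)+CM|\mathbb U|\,e^{-C^{-1}\kappa_{\pi,M}^2N}+CM^2|\mathbb U|\,e^{-C^{-1}\kappa_{\pi,M}^2\kappa_{\mathcal T,M}^2N}.$$ -/

import Mathlib

open MeasureTheory ProbabilityTheory
open scoped NNReal ENNReal

noncomputable section

namespace MDP

/-! ### Controlled Markov processes and the average cost criterion

A controlled transition kernel is a Markov kernel `T : Kernel (𝕏 × 𝕌) 𝕏`, a cost is a function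
`c : 𝕏 → 𝕌 → ℝ`. -/

section Criterion

variable {𝕏 𝕌 : Type*} [MeasurableSpace 𝕏] [MeasurableSpace 𝕌]

/-- An admissible (history dependent, randomized) policy. The history available at time `t`,
`(x₀, u₀, …, x_{t-1}, u_{t-1}, x_t)`, is stored as the pair of the past state-action pairs
`(x_s, u_s)`, `s < t`, and the current state `x_t`. -/
structure Policy (𝕏 𝕌 : Type*) [MeasurableSpace 𝕏] [MeasurableSpace 𝕌] where
  kernel : (t : ℕ) → Kernel ((Fin t → 𝕏 × 𝕌) × 𝕏) 𝕌
  markov : ∀ t, IsMarkovKernel (kernel t)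

instance (γ : Policy 𝕏 𝕌) (t : ℕ) : IsMarkovKernel (γ.kernel t) := γ.markov t

/-- The deterministic stationary policy `u_t = f (x_t)`. -/
def Policy.stationary (f : 𝕏 → 𝕌) (hf : Measurable f) : Policy 𝕏 𝕌 where
  kernel _ := Kernel.deterministic (fun h => f h.2) (hf.comp measurable_snd)
  markov _ := inferInstance

/-- From the state-action pairs at times `0, …, t` and the state at time `t + 1`, the history
available at time `t + 1`. -/
def nextHistory (t : ℕ) (p : (Finset.Iic t → 𝕏 × 𝕌) × 𝕏) : (Fin (t + 1) → 𝕏 × 𝕌) × 𝕏 :=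
  (fun s => p.1 ⟨s, Finset.mem_Iic.2 (Nat.lt_succ_iff.1 s.2)⟩, p.2)

theorem measurable_nextHistory (t : ℕ) :
    Measurable (nextHistory t : (Finset.Iic t → 𝕏 × 𝕌) × 𝕏 → _) := by
  unfold nextHistory
  fun_prop

/-- The most recent state-action pair. -/
def lastPair (t : ℕ) (z : Finset.Iic t → 𝕏 × 𝕌) : 𝕏 × 𝕌 :=
  z ⟨t, Finset.mem_Iic.2 le_rfl⟩

theorem measurable_lastPair (t : ℕ) :
    Measurable (lastPair t : (Finset.Iic t → 𝕏 × 𝕌) → _) := by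
  unfold lastPair
  fun_prop

/-- Law of `(x_{t+1}, u_{t+1})` given the state-action pairs up to time `t`:
`x_{t+1} ∼ T(· | x_t, u_t)`, then `u_{t+1} ∼ γ_{t+1}(history)`. -/
def stepKernel (T : Kernel (𝕏 × 𝕌) 𝕏) (γ : Policy 𝕏 𝕌) (t : ℕ) :
    Kernel (Finset.Iic t → 𝕏 × 𝕌) (𝕏 × 𝕌) :=
  (T.comap (lastPair t) (measurable_lastPair t)) ⊗ₖ
    ((γ.kernel (t + 1)).comap (nextHistory t) (measurable_nextHistory t))

instance (T : Kernel (𝕏 × 𝕌) 𝕏) [IsMarkovKernel T] (γ : Policy 𝕏 𝕌) (t : ℕ) :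
    IsMarkovKernel (stepKernel T γ t) := by
  unfold stepKernel
  infer_instance

/-- Law of `(x_0, u_0)` when the process starts at `x`. -/
def initialLaw (γ : Policy 𝕏 𝕌) (x : 𝕏) : Measure (𝕏 × 𝕌) :=
  (Measure.dirac x) ⊗ₘ
    ((γ.kernel 0).comap (fun y => ((fun s => s.elim0 : Fin 0 → 𝕏 × 𝕌), y)) (by fun_prop))

instance (γ : Policy 𝕏 𝕌) (x : 𝕏) : IsProbabilityMeasure (initialLaw γ x) := by
  unfold initialLaw
  infer_instance

/-- Law of the state-action process `(x_t, u_t)_{t ≥ 0}` under the kernel `T` and the policy `γ`,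
started at `x` (Ionescu-Tulcea). -/
def pathLaw (T : Kernel (𝕏 × 𝕌) 𝕏) [IsMarkovKernel T] (γ : Policy 𝕏 𝕌) (x : 𝕏) :
    Measure (ℕ → 𝕏 × 𝕌) :=
  Kernel.trajMeasure (X := fun _ => 𝕏 × 𝕌) (initialLaw γ x) (stepKernel T γ)

/-- The average cost `limsup_n (1/n) 𝔼[∑_{t<n} c(x_t, u_t) | x_0 = x]` of a policy. -/
def avgCost (c : 𝕏 → 𝕌 → ℝ) (T : Kernel (𝕏 × 𝕌) 𝕏) [IsMarkovKernel T] (γ : Policy 𝕏 𝕌)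
    (x : 𝕏) : ℝ :=
  Filter.limsup (fun n : ℕ =>
    (1 / (n : ℝ)) * ∫ z, ∑ t ∈ Finset.range n, c (z t).1 (z t).2 ∂(pathLaw T γ x)) Filter.atTop

/-- The optimal average cost, over all admissible policies. -/
def optAvgCost (c : 𝕏 → 𝕌 → ℝ) (T : Kernel (𝕏 × 𝕌) 𝕏) [IsMarkovKernel T] (x : 𝕏) : ℝ :=
  ⨅ γ : Policy 𝕏 𝕌, avgCost c T γ x

/-- The deterministic stationary policy `f` is average cost optimal, from every initial state. -/
def IsAvgOptimal (c : 𝕏 → 𝕌 → ℝ) (T : Kernel (𝕏 × 𝕌) 𝕏) [IsMarkovKernel T] (f : 𝕏 → 𝕌)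
    (hf : Measurable f) : Prop :=
  ∀ x, avgCost c T (Policy.stationary f hf) x = optAvgCost c T x

end Criterion

/-! ### Assumptions on the reference model -/

/-- The Wasserstein-1 distance, as an infimum over couplings. -/
def wasserstein1 {𝕏 : Type*} [MetricSpace 𝕏] [MeasurableSpace 𝕏] (μ ν : Measure 𝕏) : ℝ≥0∞ :=
  ⨅ (q : Measure (𝕏 × 𝕏)) (_ : q.map Prod.fst = μ ∧ q.map Prod.snd = ν),
    ∫⁻ p, edist p.1 p.2 ∂q

/-- Standing regularity of the model: the cost is nonnegative, continuous, bounded by `cSup`, and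
`Lc`-Lipschitz in the state; the kernel is weakly continuous and `LT`-Lipschitz in the state for
the Wasserstein-1 distance. -/
structure WassersteinRegular {𝕏 𝕌 : Type*} [MetricSpace 𝕏] [MeasurableSpace 𝕏]
    [TopologicalSpace 𝕌] [MeasurableSpace 𝕌]
    (c : 𝕏 → 𝕌 → ℝ) (T : Kernel (𝕏 × 𝕌) 𝕏) (cSup : ℝ) (Lc LT : ℝ≥0) : Prop where
  cost_nonneg : ∀ x u, 0 ≤ c x u
  cost_le : ∀ x u, c x u ≤ cSup
  cost_continuous : Continuous (fun p : 𝕏 × 𝕌 => c p.1 p.2)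
  kernel_continuous : ∀ v : BoundedContinuousFunction 𝕏 ℝ,
    Continuous (fun p : 𝕏 × 𝕌 => ∫ y, v y ∂(T p))
  cost_lipschitz : ∀ u, LipschitzWith Lc (fun x => c x u)
  kernel_lipschitz : ∀ u x y, wasserstein1 (T (x, u)) (T (y, u)) ≤ LT * edist x y

/-- The minorization condition with probability measure `ρ` and constant `ε`. -/
def Minorized {𝕏 𝕌 : Type*} [MeasurableSpace 𝕏] [MeasurableSpace 𝕌]
    (T : Kernel (𝕏 × 𝕌) 𝕏) (ρ : Measure 𝕏) (ε : ℝ) : Prop :=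
  ∀ x u (A : Set 𝕏), MeasurableSet A → ENNReal.ofReal ε * ρ A ≤ T (x, u) A

/-! ### The data generating chain -/

section Data

variable {𝕏 𝕌 Ω : Type*} [MeasurableSpace 𝕏] [MeasurableSpace 𝕌] [MeasurableSpace Ω]

/-- `(X_n, U_n)` is a Markov chain with the dynamics given by `T` and the state-independent
exploration law `γ`: conditionally on `(X_k, U_k)_{k ≤ n}`, the next pair `(X_{n+1}, U_{n+1})` has
law `T(· | X_n, U_n) ⊗ γ`. -/
structure IsExplorationChain (T : Kernel (𝕏 × 𝕌) 𝕏) (γ : Measure 𝕌) (P : Measure Ω)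
    (X : ℕ → Ω → 𝕏) (U : ℕ → Ω → 𝕌) : Prop where
  measurable_state : ∀ n, Measurable (X n)
  measurable_action : ∀ n, Measurable (U n)
  transition : ∀ n,
    P.map (fun ω => ((fun k : Finset.Iic n => (X k ω, U k ω)), (X (n + 1) ω, U (n + 1) ω))) =
      (P.map (fun ω => (fun k : Finset.Iic n => (X k ω, U k ω)))) ⊗ₘ
        ((T ×ₖ Kernel.const (𝕏 × 𝕌) γ).comap (lastPair n) (measurable_lastPair n))

/-- The law of `(x, u, x')` when `x ∼ π`, `u ∼ γ` are independent and `x' ∼ T(· | x, u)`. -/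
def tripleLaw (T : Kernel (𝕏 × 𝕌) 𝕏) (γ : Measure 𝕌) (π : Measure 𝕏) :
    Measure (𝕏 × 𝕌 × 𝕏) :=
  ((π.prod γ) ⊗ₘ T).map MeasurableEquiv.prodAssoc

/-- The transition kernel of the augmented chain `Z_n = (X_n, U_n, X_{n+1})`: from `(x, u, x')` to
`(x', u', x'')` with `u' ∼ γ` and `x'' ∼ T(· | x', u')`. -/
def tripleKernel (T : Kernel (𝕏 × 𝕌) 𝕏) (γ : Measure 𝕌) :
    Kernel (𝕏 × 𝕌 × 𝕏) (𝕏 × 𝕌 × 𝕏) :=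
  (((Kernel.id ×ₖ Kernel.const 𝕏 γ) ⊗ₖ Kernel.prodMkLeft 𝕏 T).map
    MeasurableEquiv.prodAssoc).comap (fun z => z.2.2) (by fun_prop)

/-- Ergodicity of the augmented chain and sub-Gaussian concentration of its empirical averages:
the chain is `ψ`-irreducible, its unique invariant probability is `tripleLaw T γ π`, and averages
of `[0,1]`-valued functions concentrate with constants `C₀, c₀`. -/
structure ErgodicConcentration [Fintype 𝕌] (T : Kernel (𝕏 × 𝕌) 𝕏) (γ : Measure 𝕌)
    (π : Measure 𝕏) (P : Measure Ω) (X : ℕ → Ω → 𝕏) (U : ℕ → Ω → 𝕌) (C₀ c₀ : ℝ) : Prop where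
  irreducible : ∃ ψ : Measure (𝕏 × 𝕌 × 𝕏), SigmaFinite ψ ∧ ψ ≠ 0 ∧
    Kernel.IsIrreducible ψ (tripleKernel T γ)
  invariant : Kernel.Invariant (tripleKernel T γ) (tripleLaw T γ π)
  unique_invariant : ∀ ν : Measure (𝕏 × 𝕌 × 𝕏), IsProbabilityMeasure ν →
    Kernel.Invariant (tripleKernel T γ) ν → ν = tripleLaw T γ π
  concentration : ∀ f : 𝕏 × 𝕌 × 𝕏 → ℝ, Measurable f → (∀ z, f z ∈ Set.Icc (0 : ℝ) 1) →
    ∀ η : ℝ, 0 < η → ∀ n : ℕ, 1 ≤ n →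
      P.real {ω | η ≤ |(n : ℝ)⁻¹ * ∑ t ∈ Finset.range n, f (X t ω, U t ω, X (t + 1) ω)
          - ∫ x, ∑ u, (∫ x', f (x, u, x') ∂(T (x, u))) * γ.real {u} ∂π|}
        ≤ C₀ * Real.exp (-(c₀ * n * η ^ 2))

end Data

/-! ### Quantization and the learned finite model

The finite state space is the set `Fin M` of labels of the bins. -/

/-- A measurable partition of the state space into `M` bins. -/
structure StatePartition (𝕏 : Type*) [MeasurableSpace 𝕏] (M : ℕ) where
  bin : Fin M → Set 𝕏
  measurableSet_bin : ∀ i, MeasurableSet (bin i)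
  disjoint_bin : ∀ i j, i ≠ j → Disjoint (bin i) (bin j)
  cover : ∀ x, ∃ i, x ∈ bin i

namespace StatePartition

variable {𝕏 : Type*} [MeasurableSpace 𝕏] {M : ℕ}

/-- The quantizer: the label of the bin containing `x`. -/
def index (B : StatePartition 𝕏 M) (x : 𝕏) : Fin M := (B.cover x).choose

theorem mem_bin_index (B : StatePartition 𝕏 M) (x : 𝕏) : x ∈ B.bin (B.index x) :=
  (B.cover x).choose_spec

theorem index_eq_iff (B : StatePartition 𝕏 M) (x : 𝕏) (i : Fin M) :
    B.index x = i ↔ x ∈ B.bin i := by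
  constructor
  · rintro rfl
    exact B.mem_bin_index x
  · intro h
    by_contra hne
    exact Set.disjoint_left.1 (B.disjoint_bin _ _ hne) (B.mem_bin_index x) h

theorem measurable_index (B : StatePartition 𝕏 M) : Measurable B.index := by
  refine measurable_to_countable' fun i => ?_
  have : B.index ⁻¹' {i} = B.bin i := by
    ext x
    simpa using B.index_eq_iff x i
  rw [this]
  exact B.measurableSet_bin i

/-- The largest diameter of a bin (possibly infinite). -/
def mesh {𝕏 : Type*} [MetricSpace 𝕏] [MeasurableSpace 𝕏] {M : ℕ} (B : StatePartition 𝕏 M) :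
    ℝ≥0∞ :=
  ⨆ i, Metric.ediam (B.bin i)

end StatePartition

section FiniteModel

variable {𝕏 𝕌 : Type*} [MeasurableSpace 𝕏] [MeasurableSpace 𝕌] {M : ℕ}

/-- The transition matrix of the finite model obtained by averaging over each bin with weight
`π`. -/
def quantizedTransition (B : StatePartition 𝕏 M) (T : Kernel (𝕏 × 𝕌) 𝕏) (π : Measure 𝕏)
    (i : Fin M) (u : 𝕌) (j : Fin M) : ℝ :=
  (∫ x in B.bin i, (T (x, u)).real (B.bin j) ∂π) / π.real (B.bin i)

/-- The smallest value of `γ_u π(B_i)`. -/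
def kappaPi (B : StatePartition 𝕏 M) (γ : Measure 𝕌) (π : Measure 𝕏) : ℝ :=
  ⨅ p : Fin M × 𝕌, γ.real {p.2} * π.real (B.bin p.1)

/-- The smallest nonzero entry of the transition matrix of the averaged finite model. -/
def kappaT (B : StatePartition 𝕏 M) (T : Kernel (𝕏 × 𝕌) 𝕏) (π : Measure 𝕏) : ℝ :=
  sInf {r | ∃ i u j, r = quantizedTransition B T π i u j ∧ 0 < quantizedTransition B T π i u j}

open Classical in
/-- The times `n < N` at which the trajectory is in bin `i` and action `u` is taken. -/
def visits (B : StatePartition 𝕏 M) (N : ℕ) (xs : ℕ → 𝕏) (us : ℕ → 𝕌) (i : Fin M) (u : 𝕌) :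
    Finset ℕ :=
  (Finset.range N).filter (fun n => xs n ∈ B.bin i ∧ us n = u)

open Classical in
/-- The empirical transition matrix from the trajectory `x_0, u_0, …, u_{N-1}, x_N`. -/
def empTransition (B : StatePartition 𝕏 M) (N : ℕ) (xs : ℕ → 𝕏) (us : ℕ → 𝕌)
    (i : Fin M) (u : 𝕌) (j : Fin M) : ℝ :=
  if (visits B N xs us i u).card = 0 then (if j = i then 1 else 0)
  else (((visits B N xs us i u).filter (fun n => xs (n + 1) ∈ B.bin j)).card : ℝ) /
    ((visits B N xs us i u).card : ℝ)

/-- The empirical cost from the trajectory. -/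
def empCost (B : StatePartition 𝕏 M) (c : 𝕏 → 𝕌 → ℝ) (N : ℕ) (xs : ℕ → 𝕏) (us : ℕ → 𝕌)
    (i : Fin M) (u : 𝕌) : ℝ :=
  if (visits B N xs us i u).card = 0 then 0
  else (∑ n ∈ visits B N xs us i u, c (xs n) (us n)) / ((visits B N xs us i u).card : ℝ)

theorem empTransition_nonneg (B : StatePartition 𝕏 M) (N : ℕ) (xs : ℕ → 𝕏) (us : ℕ → 𝕌)
    (i : Fin M) (u : 𝕌) (j : Fin M) : 0 ≤ empTransition B N xs us i u j := by
  unfold empTransition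
  split_ifs <;> positivity

theorem sum_empTransition (B : StatePartition 𝕏 M) (N : ℕ) (xs : ℕ → 𝕏) (us : ℕ → 𝕌)
    (i : Fin M) (u : 𝕌) : ∑ j, empTransition B N xs us i u j = 1 := by
  classical
  unfold empTransition
  split_ifs with h
  · simp
  · have h0 : ((visits B N xs us i u).card : ℝ) ≠ 0 := by exact_mod_cast h
    have key : (visits B N xs us i u).card =
        ∑ j : Fin M, ((visits B N xs us i u).filter (fun n => xs (n + 1) ∈ B.bin j)).card := by
      rw [Finset.card_eq_sum_card_fiberwise (f := fun n => B.index (xs (n + 1)))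
        (t := Finset.univ) (fun _ _ => Finset.mem_coe.2 (Finset.mem_univ _))]
      refine Finset.sum_congr rfl fun j _ => ?_
      congr 1
      ext n
      simp [B.index_eq_iff]
    rw [← Finset.sum_div, ← Nat.cast_sum, ← key, div_self h0]

/-- The empirical transition matrix as a probability mass function, for each label and action. -/
def empPMF (B : StatePartition 𝕏 M) (N : ℕ) (xs : ℕ → 𝕏) (us : ℕ → 𝕌) (i : Fin M) (u : 𝕌) :
    PMF (Fin M) :=
  PMF.ofFintype (fun j => ENNReal.ofReal (empTransition B N xs us i u j)) (by
    rw [← ENNReal.ofReal_sum_of_nonneg (fun j _ => empTransition_nonneg B N xs us i u j),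
      sum_empTransition, ENNReal.ofReal_one])

/-- The empirical transition matrix as a controlled transition kernel on the labels. -/
def empKernel [Finite 𝕌] [MeasurableSingletonClass 𝕌] (B : StatePartition 𝕏 M) (N : ℕ)
    (xs : ℕ → 𝕏) (us : ℕ → 𝕌) : Kernel (Fin M × 𝕌) (Fin M) where
  toFun p := (empPMF B N xs us p.1 p.2).toMeasure
  measurable' := measurable_of_finite _

instance [Finite 𝕌] [MeasurableSingletonClass 𝕌] (B : StatePartition 𝕏 M) (N : ℕ)
    (xs : ℕ → 𝕏) (us : ℕ → 𝕌) : IsMarkovKernel (empKernel B N xs us) :=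
  ⟨fun p => inferInstanceAs (IsProbabilityMeasure (empPMF B N xs us p.1 p.2).toMeasure)⟩

/-- The piecewise constant extension to `𝕏` of a deterministic stationary policy on the labels. -/
def extendPolicy (B : StatePartition 𝕏 M) (g : Fin M → 𝕌) : Policy 𝕏 𝕌 :=
  Policy.stationary (fun x => g (B.index x)) ((measurable_of_finite g).comp B.measurable_index)

end FiniteModel

end MDP

end

/-! Subtracting the minorizing part `ε ρ` from the kernel turns the Bellman operator into a sup-norm
contraction of modulus `1 - ε`. Its fixed point `h` solves the average-cost optimality equation with
constant gain `ε ∫ h dρ` (`exists_averageCost_solution`). Since the kernel contracts Wasserstein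
distance, iteration preserves a Lipschitz bound, so `h` is almost constant on each bin.

Only this one deterministic function, sampled on the bins, has to be tested against the data. The
empirical one-step operator at `h` differs from the true one by a multiple of the mesh plus ratios
of `2 M |𝕌|` scalar fluctuations. A maximal inequality (`lintegral_iSup_ofReal_le`) turns these into
the term with `log (M |𝕌|)`, free of `kappaT`. Accuracy of the individual nonzero transition entries
is needed only qualitatively: it makes the empirical model inherit the minorization with constant `ε
/ 2` and the support of the averaged model. Failure of that accuracy is exponentially unlikely and
costs at most the supremum of `c`.

The delicate point is that an average-cost optimal policy need not satisfy the Bellman equation at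
transient states. It does satisfy it on a closed set of labels carrying the minorizing measure
(`exists_closed_set_of_isAvgOptimal`). Invariance of `π` and the inherited supports make the
corresponding bins, minus a `π`-null set, absorbing in the original space. That set is entered with
uniformly positive probability from anywhere, so a penalty added to `h` outside it gives the regret
bound from every initial state (`abs_avgCost_extendPolicy_sub_le`, `abs_regret_le_of_good_path`). -/

namespace MDP

/-! ### Path laws and verification inequalities for the average cost. -/

section Criterion

variable {𝕏 𝕌 : Type*} [MeasurableSpace 𝕏] [MeasurableSpace 𝕌]

instance (T : Kernel (𝕏 × 𝕌) 𝕏) [IsMarkovKernel T] (γ : Policy 𝕏 𝕌) (x : 𝕏) :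
    IsProbabilityMeasure (pathLaw T γ x) := by
  unfold pathLaw
  infer_instance

theorem integrable_of_abs_le {α : Type*} [MeasurableSpace α] {μ : Measure α} [IsFiniteMeasure μ]
    {v : α → ℝ} (hv : Measurable v) {K : ℝ} (hK : ∀ x, |v x| ≤ K) : Integrable v μ :=
  Integrable.of_bound hv.aestronglyMeasurable K (Filter.Eventually.of_forall hK)

theorem abs_integral_le_of_abs_le {α : Type*} [MeasurableSpace α] {μ : Measure α}
    [IsProbabilityMeasure μ] {v : α → ℝ} {K : ℝ} (hK : ∀ x, |v x| ≤ K) : |∫ x, v x ∂μ| ≤ K := by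
  simpa using norm_integral_le_of_norm_le_const (μ := μ) (f := v) (C := K)
    (Filter.Eventually.of_forall hK)

theorem measurable_integral_kernel {α β : Type*} [MeasurableSpace α] [MeasurableSpace β]
    (T : Kernel α β) [IsMarkovKernel T] {v : β → ℝ} (hv : Measurable v) :
    Measurable (fun p => ∫ y, v y ∂(T p)) :=
  (hv.stronglyMeasurable.integral_kernel (κ := T)).measurable

/-- The state at time `t + 1` has conditional law `T` given the state-action pair at time `t`. -/
theorem integral_pathLaw_succ (T : Kernel (𝕏 × 𝕌) 𝕏) [IsMarkovKernel T] (γ : Policy 𝕏 𝕌) (x : 𝕏)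
    {v : 𝕏 → ℝ} (hv : Measurable v) {K : ℝ} (hK : ∀ x, |v x| ≤ K) (t : ℕ) :
    ∫ z, v (z (t + 1)).1 ∂(pathLaw T γ x) = ∫ z, ∫ y, v y ∂(T (z t)) ∂(pathLaw T γ x) := by
  have key := Kernel.map_frestrictLe_trajMeasure_compProd_eq_map_trajMeasure
    (X := fun _ => 𝕏 × 𝕌) (μ₀ := initialLaw γ x) (κ := stepKernel T γ) (a := t)
  have h1 : ∫ z, v (z (t + 1)).1 ∂(pathLaw T γ x) =
      ∫ p, v p.2.1 ∂((pathLaw T γ x).map (fun z => (Preorder.frestrictLe t z, z (t + 1)))) := by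
    have hm : Measurable (fun p : ((i : Finset.Iic t) → 𝕏 × 𝕌) × (𝕏 × 𝕌) => v p.2.1) :=
      hv.comp (measurable_fst.comp measurable_snd)
    rw [integral_map (by fun_prop) hm.aestronglyMeasurable]
  rw [h1, pathLaw, ← key, Measure.integral_compProd
    (integrable_of_abs_le (by fun_prop) (fun p => hK _)), integral_map (by fun_prop)]
  · refine integral_congr_ae (Filter.Eventually.of_forall fun z => ?_)
    have h2 : (stepKernel T γ t (Preorder.frestrictLe t z)).map Prod.fst = T (z t) := by
      rw [← Kernel.map_apply _ measurable_fst, ← Kernel.fst_eq, stepKernel, Kernel.fst_compProd]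
      rfl
    simp only
    rw [← h2, integral_map (by fun_prop) (by fun_prop)]
  · have : StronglyMeasurable (fun p : ((i : Finset.Iic t) → 𝕏 × 𝕌) × (𝕏 × 𝕌) => v p.2.1) :=
      (hv.comp (by fun_prop)).stronglyMeasurable
    exact (this.integral_kernel_prod_right' (κ := stepKernel T γ t)).aestronglyMeasurable

theorem map_pathLaw_zero (T : Kernel (𝕏 × 𝕌) 𝕏) [IsMarkovKernel T] (γ : Policy 𝕏 𝕌) (x : 𝕏) :
    (pathLaw T γ x).map (fun z => z 0) = initialLaw γ x := by
  have h : (pathLaw T γ x).map (Preorder.frestrictLe 0) =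
      (initialLaw γ x).map (MeasurableEquiv.piUnique (fun _ : Finset.Iic 0 => 𝕏 × 𝕌)).symm := by
    rw [pathLaw, Kernel.trajMeasure, Measure.map_comp _ _ (by fun_prop),
      Kernel.traj_map_frestrictLe, Kernel.partialTraj_self]
    exact Measure.id_comp
  have h' := congrArg (Measure.map (fun y => y ⟨0, Finset.mem_Iic.2 le_rfl⟩)) h
  rw [Measure.map_map (by fun_prop) (by fun_prop),
    Measure.map_map (by fun_prop) (by fun_prop)] at h'
  rw [show (fun z : ℕ → 𝕏 × 𝕌 => z 0) = (fun y : (i : Finset.Iic 0) → 𝕏 × 𝕌 =>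
    y ⟨0, Finset.mem_Iic.2 le_rfl⟩) ∘ Preorder.frestrictLe 0 from rfl, h']
  exact Measure.map_id

/-- Under a stationary policy `f`, the action at each time is `f` of the state. -/
theorem ae_pathLaw_stationary (T : Kernel (𝕏 × 𝕌) 𝕏) [IsMarkovKernel T] {f : 𝕏 → 𝕌}
    (hf : Measurable f) (x : 𝕏) {S : Set (𝕏 × 𝕌)} (hS : MeasurableSet S)
    (hfS : ∀ y, (y, f y) ∈ S) (t : ℕ) :
    ∀ᵐ z ∂(pathLaw T (Policy.stationary f hf) x), z t ∈ S := by
  cases t with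
  | zero =>
    suffices h : ∀ᵐ p ∂((pathLaw T (Policy.stationary f hf) x).map (fun z => z 0)), p ∈ S from
      ae_of_ae_map (measurable_pi_apply 0).aemeasurable h
    rw [map_pathLaw_zero, initialLaw, Measure.ae_compProd_iff (p := fun p => p ∈ S) hS]
    refine Filter.Eventually.of_forall fun y => ?_
    simp only [Policy.stationary, Kernel.comap_apply, Kernel.deterministic_apply]
    rw [ae_dirac_iff (measurable_prodMk_left hS)]
    exact hfS y
  | succ t =>
    have key := Kernel.map_frestrictLe_trajMeasure_compProd_eq_map_trajMeasure
      (X := fun _ => 𝕏 × 𝕌) (μ₀ := initialLaw (Policy.stationary f hf) x)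
      (κ := stepKernel T (Policy.stationary f hf)) (a := t)
    suffices h : ∀ᵐ p ∂((pathLaw T (Policy.stationary f hf) x).map
        (fun z => (Preorder.frestrictLe t z, z (t + 1)))), p.2 ∈ S from
      ae_of_ae_map (f := fun z : ℕ → 𝕏 × 𝕌 => (Preorder.frestrictLe t z, z (t + 1)))
        (p := fun p => p.2 ∈ S) ((Preorder.measurable_frestrictLe t).prodMk (measurable_pi_apply (t + 1))).aemeasurable h
    rw [pathLaw, ← key, Measure.ae_compProd_iff (p := fun p => p.2 ∈ S) (measurable_snd hS)]
    refine Filter.Eventually.of_forall fun y => ?_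
    rw [stepKernel, Kernel.ae_compProd_iff (p := fun p => p ∈ S) hS]
    refine Filter.Eventually.of_forall fun q => ?_
    simp only [Policy.stationary, Kernel.comap_apply, Kernel.deterministic_apply]
    rw [ae_dirac_iff (measurable_prodMk_left hS)]
    exact hfS _

variable {c : 𝕏 → 𝕌 → ℝ} {T : Kernel (𝕏 × 𝕌) 𝕏} [IsMarkovKernel T] {Kc Kv g : ℝ}

/-- The average cost over the first `n` steps. -/
noncomputable def finiteAvgCost (c : 𝕏 → 𝕌 → ℝ) (T : Kernel (𝕏 × 𝕌) 𝕏) [IsMarkovKernel T]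
    (γ : Policy 𝕏 𝕌) (x : 𝕏) (n : ℕ) : ℝ :=
  (1 / (n : ℝ)) * ∫ z, ∑ t ∈ Finset.range n, c (z t).1 (z t).2 ∂(pathLaw T γ x)

theorem abs_finiteAvgCost_le (hcK : ∀ x u, |c x u| ≤ Kc) (γ : Policy 𝕏 𝕌) (x : 𝕏) (n : ℕ) :
    |finiteAvgCost c T γ x n| ≤ |Kc| := by
  unfold finiteAvgCost
  rw [abs_mul, abs_of_nonneg (by positivity : (0 : ℝ) ≤ 1 / n)]
  have h : |∫ z, ∑ t ∈ Finset.range n, c (z t).1 (z t).2 ∂(pathLaw T γ x)| ≤ n * |Kc| := by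
    refine abs_integral_le_of_abs_le fun z => (Finset.abs_sum_le_sum_abs _ _).trans ?_
    exact (Finset.sum_le_sum fun t _ => (hcK (z t).1 (z t).2).trans (le_abs_self Kc)).trans
      (by simp)
  rcases Nat.eq_zero_or_pos n with rfl | hn
  · simp
  · calc 1 / (n : ℝ) * _ ≤ 1 / (n : ℝ) * (n * |Kc|) := by gcongr
      _ = |Kc| := by field_simp

theorem isBoundedUnder_le_finiteAvgCost (hcK : ∀ x u, |c x u| ≤ Kc) (γ : Policy 𝕏 𝕌) (x : 𝕏) :
    Filter.IsBoundedUnder (· ≤ ·) Filter.atTop (finiteAvgCost c T γ x) :=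
  Filter.isBoundedUnder_of ⟨|Kc|, fun n => (abs_le.1 (abs_finiteAvgCost_le hcK γ x n)).2⟩

theorem isBoundedUnder_ge_finiteAvgCost (hcK : ∀ x u, |c x u| ≤ Kc) (γ : Policy 𝕏 𝕌) (x : 𝕏) :
    Filter.IsBoundedUnder (· ≥ ·) Filter.atTop (finiteAvgCost c T γ x) :=
  Filter.isBoundedUnder_of ⟨-|Kc|, fun n => (abs_le.1 (abs_finiteAvgCost_le hcK γ x n)).1⟩

theorem avgCost_nonneg (hcK : ∀ x u, |c x u| ≤ Kc) (hc0 : ∀ x u, 0 ≤ c x u) (γ : Policy 𝕏 𝕌)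
    (x : 𝕏) : 0 ≤ avgCost c T γ x := by
  refine Filter.le_limsup_of_frequently_le (Filter.Frequently.of_forall fun n => ?_)
    (isBoundedUnder_le_finiteAvgCost hcK γ x)
  exact mul_nonneg (by positivity) (integral_nonneg fun z => Finset.sum_nonneg fun t _ => hc0 _ _)

theorem avgCost_le_bound (hcK : ∀ x u, |c x u| ≤ Kc) (γ : Policy 𝕏 𝕌) (x : 𝕏) :
    avgCost c T γ x ≤ |Kc| :=
  Filter.limsup_le_of_le (isBoundedUnder_ge_finiteAvgCost hcK γ x).isCoboundedUnder_le
    (Filter.Eventually.of_forall fun n => (abs_le.1 (abs_finiteAvgCost_le hcK γ x n)).2)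

theorem optAvgCost_le (hcK : ∀ x u, |c x u| ≤ Kc) (hc0 : ∀ x u, 0 ≤ c x u) (γ : Policy 𝕏 𝕌)
    (x : 𝕏) : optAvgCost c T x ≤ avgCost c T γ x :=
  ciInf_le ⟨0, by rintro _ ⟨γ, rfl⟩; exact avgCost_nonneg hcK hc0 γ x⟩ γ

/-- The expected increments of the potential `v` telescope, so the total cost equals the sum of the
one-step Bellman defects up to a boundary term of size at most `2 * Kv`. Dividing by `n` removes
that term in the limit. -/
theorem integral_sum_pathLaw (hc : Measurable (Function.uncurry c)) (hcK : ∀ x u, |c x u| ≤ Kc)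
    {v : 𝕏 → ℝ} (hv : Measurable v) (hvK : ∀ x, |v x| ≤ Kv) (γ : Policy 𝕏 𝕌) (x : 𝕏) (n : ℕ) :
    ∫ z, ∑ t ∈ Finset.range n, c (z t).1 (z t).2 ∂(pathLaw T γ x) =
      ∑ t ∈ Finset.range n, ∫ z, (c (z t).1 (z t).2 + ∫ y, v y ∂(T (z t)) - v (z t).1)
        ∂(pathLaw T γ x)
      - (∫ z, v (z n).1 ∂(pathLaw T γ x) - ∫ z, v (z 0).1 ∂(pathLaw T γ x)) := by
  have mc : ∀ t, Measurable (fun z : ℕ → 𝕏 × 𝕌 => c (z t).1 (z t).2) := fun t =>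
    hc.comp (measurable_pi_apply t)
  have ic : ∀ t, Integrable (fun z : ℕ → 𝕏 × 𝕌 => c (z t).1 (z t).2) (pathLaw T γ x) := fun t =>
    integrable_of_abs_le (mc t) (fun z => hcK _ _)
  have iT : ∀ t, Integrable (fun z : ℕ → 𝕏 × 𝕌 => ∫ y, v y ∂(T (z t))) (pathLaw T γ x) := fun t =>
    integrable_of_abs_le ((measurable_integral_kernel T hv).comp (measurable_pi_apply t))
      (fun z => abs_integral_le_of_abs_le hvK)
  have iv : ∀ t, Integrable (fun z : ℕ → 𝕏 × 𝕌 => v (z t).1) (pathLaw T γ x) := fun t =>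
    integrable_of_abs_le (by fun_prop) (fun z => hvK _)
  rw [integral_finsetSum _ fun t _ => ic t, ← Finset.sum_range_sub (fun n => ∫ z, v (z n).1 ∂(pathLaw T γ x)), ← Finset.sum_sub_distrib]
  refine Finset.sum_congr rfl fun t _ => ?_
  have h1 := integral_sub ((ic t).add (iT t)) (iv t)
  simp only [Pi.add_apply] at h1
  rw [h1, integral_add (ic t) (iT t), integral_pathLaw_succ T γ x hv hvK]
  ring

/-- An optimality inequality along the trajectories bounds the average cost from below. -/
theorem le_avgCost_of_ae (hc : Measurable (Function.uncurry c)) (hcK : ∀ x u, |c x u| ≤ Kc)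
    {v : 𝕏 → ℝ} (hv : Measurable v) (hvK : ∀ x, |v x| ≤ Kv) (γ : Policy 𝕏 𝕌) (x : 𝕏)
    (h : ∀ t, ∀ᵐ z ∂(pathLaw T γ x), g + v (z t).1 ≤ c (z t).1 (z t).2 + ∫ y, v y ∂(T (z t))) :
    g ≤ avgCost c T γ x := by
  have mT := measurable_integral_kernel T hv
  have hn : ∀ n : ℕ, 1 ≤ n → g - 2 * Kv / n ≤ finiteAvgCost c T γ x n := by
    intro n hn
    have hn' : (0 : ℝ) < n := by exact_mod_cast hn
    unfold finiteAvgCost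
    rw [integral_sum_pathLaw hc hcK hv hvK]
    have h1 : (n : ℝ) * g ≤ ∑ t ∈ Finset.range n,
        ∫ z, (c (z t).1 (z t).2 + ∫ y, v y ∂(T (z t)) - v (z t).1) ∂(pathLaw T γ x) := by
      rw [← nsmul_eq_mul]
      nth_rewrite 1 [← Finset.card_range n]
      refine Finset.card_nsmul_le_sum _ _ _ fun t _ => ?_
      have : ∫ _, g ∂(pathLaw T γ x) = g := by simp
      rw [← this]
      refine integral_mono_ae (integrable_const _) ?_ ?_
      · refine integrable_of_abs_le (K := Kc + Kv + Kv) (((hc.comp (measurable_pi_apply t)).add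
          (mT.comp (measurable_pi_apply t))).sub (by fun_prop)) fun z => ?_
        refine (abs_sub _ _).trans (add_le_add ((abs_add_le _ _).trans (add_le_add (hcK _ _) ?_))
          (hvK _))
        exact abs_integral_le_of_abs_le hvK
      · filter_upwards [h t] with z hz
        linarith
    have h2 := abs_le.1 (abs_integral_le_of_abs_le (μ := pathLaw T γ x)
      (v := fun z => v (z n).1) (fun z => hvK _))
    have h3 := abs_le.1 (abs_integral_le_of_abs_le (μ := pathLaw T γ x)
      (v := fun z => v (z 0).1) (fun z => hvK _))
    calc g - 2 * Kv / n = 1 / n * (n * g - 2 * Kv) := by field_simp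
      _ ≤ _ := by gcongr; linarith
  have lim : Filter.Tendsto (fun n : ℕ => g - 2 * Kv / n) Filter.atTop (nhds g) := by
    simpa using (tendsto_const_nhds (x := g)).sub (tendsto_const_div_atTop_nhds_zero_nat (2 * Kv))
  rw [← lim.limsup_eq]
  exact Filter.limsup_le_limsup ((Filter.eventually_ge_atTop 1).mono hn)
    lim.isCoboundedUnder_le (isBoundedUnder_le_finiteAvgCost hcK γ x)

theorem avgCost_le_of_ae (hc : Measurable (Function.uncurry c)) (hcK : ∀ x u, |c x u| ≤ Kc)
    {v : 𝕏 → ℝ} (hv : Measurable v) (hvK : ∀ x, |v x| ≤ Kv) (γ : Policy 𝕏 𝕌) (x : 𝕏)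
    (h : ∀ t, ∀ᵐ z ∂(pathLaw T γ x), c (z t).1 (z t).2 + ∫ y, v y ∂(T (z t)) ≤ g + v (z t).1) :
    avgCost c T γ x ≤ g := by
  have mT := measurable_integral_kernel T hv
  have hn : ∀ n : ℕ, 1 ≤ n → finiteAvgCost c T γ x n ≤ g + 2 * Kv / n := by
    intro n hn
    have hn' : (0 : ℝ) < n := by exact_mod_cast hn
    unfold finiteAvgCost
    rw [integral_sum_pathLaw hc hcK hv hvK]
    have h1 : ∑ t ∈ Finset.range n, ∫ z, (c (z t).1 (z t).2 + ∫ y, v y ∂(T (z t)) - v (z t).1)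
        ∂(pathLaw T γ x) ≤ (n : ℝ) * g := by
      rw [← nsmul_eq_mul]
      nth_rewrite 2 [← Finset.card_range n]
      refine Finset.sum_le_card_nsmul _ _ _ fun t _ => ?_
      have : ∫ _, g ∂(pathLaw T γ x) = g := by simp
      rw [← this]
      refine integral_mono_ae ?_ (integrable_const _) ?_
      · refine integrable_of_abs_le (K := Kc + Kv + Kv) (((hc.comp (measurable_pi_apply t)).add
          (mT.comp (measurable_pi_apply t))).sub (by fun_prop)) fun z => ?_
        refine (abs_sub _ _).trans (add_le_add ((abs_add_le _ _).trans (add_le_add (hcK _ _) ?_))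
          (hvK _))
        exact abs_integral_le_of_abs_le hvK
      · filter_upwards [h t] with z hz
        linarith
    have h2 := abs_le.1 (abs_integral_le_of_abs_le (μ := pathLaw T γ x)
      (v := fun z => v (z n).1) (fun z => hvK _))
    have h3 := abs_le.1 (abs_integral_le_of_abs_le (μ := pathLaw T γ x)
      (v := fun z => v (z 0).1) (fun z => hvK _))
    calc _ ≤ 1 / (n : ℝ) * (n * g + 2 * Kv) := by gcongr; linarith
      _ = g + 2 * Kv / n := by field_simp
  have lim : Filter.Tendsto (fun n : ℕ => g + 2 * Kv / n) Filter.atTop (nhds g) := by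
    simpa using (tendsto_const_nhds (x := g)).add (tendsto_const_div_atTop_nhds_zero_nat (2 * Kv))
  rw [← lim.limsup_eq]
  exact Filter.limsup_le_limsup ((Filter.eventually_ge_atTop 1).mono hn)
    (isBoundedUnder_ge_finiteAvgCost hcK γ x).isCoboundedUnder_le lim.isBoundedUnder_le

theorem le_optAvgCost [Nonempty 𝕌] (hc : Measurable (Function.uncurry c))
    (hcK : ∀ x u, |c x u| ≤ Kc) {v : 𝕏 → ℝ} (hv : Measurable v) (hvK : ∀ x, |v x| ≤ Kv)
    (h : ∀ x u, g + v x ≤ c x u + ∫ y, v y ∂(T (x, u))) (x : 𝕏) : g ≤ optAvgCost c T x := by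
  have : Nonempty (Policy 𝕏 𝕌) :=
    ⟨Policy.stationary (fun _ => Classical.arbitrary 𝕌) measurable_const⟩
  exact le_ciInf fun γ => le_avgCost_of_ae hc hcK hv hvK γ x
    fun t => Filter.Eventually.of_forall fun z => h _ _

/-- The inequality is needed only at the action `f x`, because the process almost surely stays on
the graph of `f`. -/
theorem le_avgCost_stationary (hc : Measurable (Function.uncurry c))
    (hcK : ∀ x u, |c x u| ≤ Kc) {v : 𝕏 → ℝ} (hv : Measurable v) (hvK : ∀ x, |v x| ≤ Kv)
    {f : 𝕏 → 𝕌} (hf : Measurable f)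
    (h : ∀ x, g + v x ≤ c x (f x) + ∫ y, v y ∂(T (x, f x))) (x : 𝕏) :
    g ≤ avgCost c T (Policy.stationary f hf) x :=
  le_avgCost_of_ae hc hcK hv hvK _ x fun t =>
    ae_pathLaw_stationary T hf x (S := {p | g + v p.1 ≤ c p.1 p.2 + ∫ y, v y ∂(T p)})
      (measurableSet_le (by fun_prop) (hc.add (measurable_integral_kernel T hv))) h t

theorem avgCost_stationary_le (hc : Measurable (Function.uncurry c))
    (hcK : ∀ x u, |c x u| ≤ Kc) {v : 𝕏 → ℝ} (hv : Measurable v) (hvK : ∀ x, |v x| ≤ Kv)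
    {f : 𝕏 → 𝕌} (hf : Measurable f)
    (h : ∀ x, c x (f x) + ∫ y, v y ∂(T (x, f x)) ≤ g + v x) (x : 𝕏) :
    avgCost c T (Policy.stationary f hf) x ≤ g :=
  avgCost_le_of_ae hc hcK hv hvK _ x fun t =>
    ae_pathLaw_stationary T hf x (S := {p | c p.1 p.2 + ∫ y, v y ∂(T p) ≤ g + v p.1})
      (measurableSet_le (hc.add (measurable_integral_kernel T hv)) (by fun_prop)) h t

/-- With a single action there is nothing to optimize. -/
theorem avgCost_eq_optAvgCost_of_subsingleton [Subsingleton 𝕌] (γ : Policy 𝕏 𝕌) (x : 𝕏) :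
    avgCost c T γ x = optAvgCost c T x := by
  -- A one-point action space carries a single probability measure, so there is only one policy.
  have hs : ∀ γ' : Policy 𝕏 𝕌, γ' = γ := by
    rintro ⟨k, hk⟩
    obtain ⟨k', hk'⟩ := γ
    congr 1
    ext t h s hs
    have := hk t
    have := hk' t
    rcases s.eq_empty_or_nonempty with rfl | hne
    · simp
    · simp [Subsingleton.eq_univ_of_nonempty hne]
  have : Nonempty (Policy 𝕏 𝕌) := ⟨γ⟩
  unfold optAvgCost
  simp_rw [hs, ciInf_const]

end Criterion

/-! ### Consequences of the minorization condition. -/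

section Minorization

variable {𝕏 𝕌 : Type*} [MeasurableSpace 𝕏] [MeasurableSpace 𝕌] {T : Kernel (𝕏 × 𝕌) 𝕏}
  {ρ : Measure 𝕏} {ε : ℝ}

theorem Minorized.mono (hm : Minorized T ρ ε) {ε' : ℝ} (h : ε' ≤ ε) : Minorized T ρ ε' :=
  fun x u A hA => (mul_le_mul_left (ENNReal.ofReal_le_ofReal h) _).trans (hm x u A hA)

theorem Minorized.le_one [IsMarkovKernel T] [IsProbabilityMeasure ρ] [Nonempty 𝕌]
    (hm : Minorized T ρ ε) : ε ≤ 1 := by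
  have := ρ.nonempty_of_neZero
  simpa using hm (Classical.arbitrary 𝕏) (Classical.arbitrary 𝕌) Set.univ MeasurableSet.univ

theorem Minorized.smul_le (hm : Minorized T ρ ε) (p : 𝕏 × 𝕌) : ENNReal.ofReal ε • ρ ≤ T p :=
  Measure.le_iff.2 fun A hA => by simpa using hm p.1 p.2 A hA

theorem Minorized.mul_integral_le [IsMarkovKernel T] (hm : Minorized T ρ ε) (hε : 0 ≤ ε)
    {v : 𝕏 → ℝ} (hv : Measurable v) {K : ℝ} (h0 : ∀ x, 0 ≤ v x) (hK : ∀ x, v x ≤ K)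
    (p : 𝕏 × 𝕌) : ε * ∫ x, v x ∂ρ ≤ ∫ x, v x ∂(T p) := by
  have h := integral_mono_measure (f := v) (hm.smul_le p) (Filter.Eventually.of_forall h0)
    (integrable_of_abs_le hv (K := K) fun x => by rw [abs_of_nonneg (h0 x)]; exact hK x)
  rwa [integral_smul_measure, ENNReal.toReal_ofReal hε, smul_eq_mul] at h

/-- Subtracting the minorizing part of the kernel leaves mass `1 - ε`. -/
theorem Minorized.integral_sub_le [IsMarkovKernel T] [IsProbabilityMeasure ρ]
    (hm : Minorized T ρ ε) (hε : 0 ≤ ε) {v : 𝕏 → ℝ} (hv : Measurable v) {a b : ℝ}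
    (ha : ∀ x, a ≤ v x) (hb : ∀ x, v x ≤ b) (p : 𝕏 × 𝕌) :
    ∫ x, v x ∂(T p) - ε * ∫ x, v x ∂ρ ≤ (1 - ε) * b := by
  have hi : ∀ (μ : Measure 𝕏) [IsProbabilityMeasure μ], Integrable v μ := fun μ _ =>
    integrable_of_abs_le hv (K := max |a| |b|) fun x => abs_le_max_abs_abs (ha x) (hb x)
  -- The difference of `T p` and `ε ρ` is a positive measure of mass `1 - ε`; testing it on the
  -- nonnegative function `b - v` gives the bound.
  have h := hm.mul_integral_le hε (v := fun x => b - v x) (by fun_prop) (K := b - a)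
    (fun x => by linarith [hb x]) (fun x => by linarith [ha x]) p
  rw [integral_sub (integrable_const _) (hi ρ), integral_sub (integrable_const _) (hi (T p))] at h
  simp only [integral_const, probReal_univ, one_smul] at h
  linarith

end Minorization

/-! ### The average-cost optimality equation by contraction. -/

section FixedPoint

variable {𝕏 𝕌 : Type*} [TopologicalSpace 𝕏] [MeasurableSpace 𝕏] [OpensMeasurableSpace 𝕏]
  [MeasurableSpace 𝕌] [Fintype 𝕌] [Nonempty 𝕌] {c : 𝕏 → 𝕌 → ℝ} {T : Kernel (𝕏 × 𝕌) 𝕏}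
  [IsMarkovKernel T] {ρ : Measure 𝕏} [IsProbabilityMeasure ρ] {K ε : ℝ}

/-- The dynamic programming operator of the model with the minorizing part removed. -/
noncomputable def minorBellman (c : 𝕏 → 𝕌 → ℝ) (T : Kernel (𝕏 × 𝕌) 𝕏) (ρ : Measure 𝕏) (ε : ℝ)
    (v : 𝕏 → ℝ) (x : 𝕏) : ℝ :=
  Finset.univ.inf' Finset.univ_nonempty (fun u => c x u + ∫ y, v y ∂(T (x, u))) - ε * ∫ y, v y ∂ρ

omit [TopologicalSpace 𝕏] [OpensMeasurableSpace 𝕏] [IsMarkovKernel T]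
  [IsProbabilityMeasure ρ] in
theorem minorBellman_le (v : 𝕏 → ℝ) (x : 𝕏) (u : 𝕌) :
    minorBellman c T ρ ε v x ≤ c x u + ∫ y, v y ∂(T (x, u)) - ε * ∫ y, v y ∂ρ :=
  sub_le_sub_right (Finset.inf'_le _ (Finset.mem_univ u)) _

omit [TopologicalSpace 𝕏] [OpensMeasurableSpace 𝕏] [IsMarkovKernel T]
  [IsProbabilityMeasure ρ] in
theorem exists_minorBellman_eq (v : 𝕏 → ℝ) (x : 𝕏) :
    ∃ u, minorBellman c T ρ ε v x = c x u + ∫ y, v y ∂(T (x, u)) - ε * ∫ y, v y ∂ρ := by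
  obtain ⟨u, -, hu⟩ := Finset.exists_mem_eq_inf' (Finset.univ_nonempty (α := 𝕌))
    (fun u => c x u + ∫ y, v y ∂(T (x, u)))
  exact ⟨u, by rw [minorBellman, hu]⟩

omit [OpensMeasurableSpace 𝕏] [IsMarkovKernel T] [IsProbabilityMeasure ρ] in
theorem continuous_minorBellman (hcc : ∀ u, Continuous fun x => c x u)
    (hT : ∀ u (v : BoundedContinuousFunction 𝕏 ℝ), Continuous fun x => ∫ y, v y ∂(T (x, u)))
    (v : BoundedContinuousFunction 𝕏 ℝ) : Continuous (minorBellman c T ρ ε v) := by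
  unfold minorBellman
  refine Continuous.sub ?_ continuous_const
  exact Continuous.finset_inf'_apply _ fun u _ => (hcc u).add (hT u v)

omit [OpensMeasurableSpace 𝕏] in
theorem abs_minorBellman_le (hc0 : ∀ x u, 0 ≤ c x u) (hcK : ∀ x u, c x u ≤ K)
    (v : BoundedContinuousFunction 𝕏 ℝ) (x : 𝕏) :
    |minorBellman c T ρ ε v x| ≤ K + ‖v‖ + |ε| * ‖v‖ := by
  obtain ⟨u, hu⟩ := exists_minorBellman_eq (c := c) (T := T) (ρ := ρ) (ε := ε) v x
  rw [hu]
  refine (abs_sub _ _).trans (add_le_add ((abs_add_le _ _).trans (add_le_add ?_ ?_)) ?_)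
  · rw [abs_of_nonneg (hc0 x u)]
    exact hcK x u
  · exact abs_integral_le_of_abs_le fun y => v.norm_coe_le_norm y
  · rw [abs_mul]
    gcongr
    exact abs_integral_le_of_abs_le fun y => v.norm_coe_le_norm y

/-- Using the action that is greedy for `w` in both operators cancels the costs. What remains is `v
- w` integrated against a positive measure of mass `1 - ε`, hence the contraction factor. -/
theorem minorBellman_sub_le (hm : Minorized T ρ ε) (hε : 0 ≤ ε)
    (v w : BoundedContinuousFunction 𝕏 ℝ) (x : 𝕏) :
    minorBellman c T ρ ε v x - minorBellman c T ρ ε w x ≤ (1 - ε) * ‖v - w‖ := by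
  obtain ⟨u, hu⟩ := exists_minorBellman_eq (c := c) (T := T) (ρ := ρ) (ε := ε) w x
  have h1 := minorBellman_le (c := c) (T := T) (ρ := ρ) (ε := ε) v x u
  have hb : ∀ y, |(v - w) y| ≤ ‖v - w‖ := fun y => (v - w).norm_coe_le_norm y
  have h2 := hm.integral_sub_le hε (v := fun y => (v - w) y) (v - w).continuous.measurable
    (fun y => (abs_le.1 (hb y)).1) (fun y => (abs_le.1 (hb y)).2) (x, u)
  simp only [BoundedContinuousFunction.coe_sub, Pi.sub_apply] at h2
  rw [integral_sub (v.integrable _) (w.integrable _),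
    integral_sub (v.integrable _) (w.integrable _)] at h2
  linarith

/-- The average cost optimality equation has a solution, obtained by a contraction; it lies in
every closed set of functions containing `0` that the operator preserves. -/
theorem exists_minorBellman_fixedPoint (hε : 0 < ε) (hc0 : ∀ x u, 0 ≤ c x u)
    (hcK : ∀ x u, c x u ≤ K) (hcc : ∀ u, Continuous fun x => c x u)
    (hT : ∀ u (v : BoundedContinuousFunction 𝕏 ℝ), Continuous fun x => ∫ y, v y ∂(T (x, u)))
    (hm : Minorized T ρ ε) :
    ∃ h : BoundedContinuousFunction 𝕏 ℝ, (∀ x, minorBellman c T ρ ε h x = h x) ∧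
      ∀ S : Set (BoundedContinuousFunction 𝕏 ℝ), IsClosed S → 0 ∈ S →
        (∀ v ∈ S, ∀ w : BoundedContinuousFunction 𝕏 ℝ,
          (∀ x, w x = minorBellman c T ρ ε v x) → w ∈ S) → h ∈ S := by
  let F : BoundedContinuousFunction 𝕏 ℝ → BoundedContinuousFunction 𝕏 ℝ := fun v =>
    BoundedContinuousFunction.ofNormedAddCommGroup (minorBellman c T ρ ε v)
      (continuous_minorBellman hcc hT v) _ (abs_minorBellman_le hc0 hcK v)
  have hF : ∀ v x, F v x = minorBellman c T ρ ε v x := fun v x => rfl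
  have hε1 : ε ≤ 1 := hm.le_one
  have hcoe : ((Real.toNNReal (1 - ε) : ℝ≥0) : ℝ) = 1 - ε := Real.coe_toNNReal _ (by linarith)
  have hcon : ContractingWith (Real.toNNReal (1 - ε)) F := by
    refine ⟨by rw [← NNReal.coe_lt_coe, hcoe]; simpa using hε, LipschitzWith.of_dist_le_mul fun v w => ?_⟩
    rw [dist_eq_norm, dist_eq_norm, hcoe]
    refine (BoundedContinuousFunction.norm_le
      (mul_nonneg (by linarith) (norm_nonneg _))).2 fun x => ?_
    rw [Real.norm_eq_abs, abs_le, BoundedContinuousFunction.coe_sub, Pi.sub_apply, hF, hF]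
    have h1 := minorBellman_sub_le (c := c) hm hε.le v w x
    have h2 := minorBellman_sub_le (c := c) hm hε.le w v x
    rw [norm_sub_rev] at h2
    constructor <;> linarith
  refine ⟨hcon.fixedPoint F, fun x => ?_, fun S hS h0 hstep => ?_⟩
  · rw [← hF, hcon.fixedPoint_isFixedPt]
  -- The fixed point is the limit of the iterates started at `0`, all of which lie in `S`.
  · refine hS.mem_of_tendsto (hcon.tendsto_iterate_fixedPoint 0)
      (Filter.Eventually.of_forall fun n => ?_)
    induction n with
    | zero => exact h0
    | succ n ih =>
      rw [Function.iterate_succ_apply']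
      exact hstep _ ih _ fun x => hF _ x

/-- Moving `ε ∫ h dρ` to the other side turns the fixed-point equation into the optimality equation
with that number as gain. The range `[0, K / ε]` is preserved because `K + (1 - ε) * (K / ε) = K /
ε`. The closed-set clause is kept so that further regularity of `h`, such as a Lipschitz bound, can
be extracted later. -/
theorem exists_averageCost_solution (hε : 0 < ε) (hc0 : ∀ x u, 0 ≤ c x u)
    (hcK : ∀ x u, c x u ≤ K) (hcc : ∀ u, Continuous fun x => c x u)
    (hT : ∀ u (v : BoundedContinuousFunction 𝕏 ℝ), Continuous fun x => ∫ y, v y ∂(T (x, u)))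
    (hm : Minorized T ρ ε) :
    ∃ h : BoundedContinuousFunction 𝕏 ℝ, (∀ x, 0 ≤ h x ∧ h x ≤ K / ε) ∧
      (∀ x u, ε * ∫ y, h y ∂ρ + h x ≤ c x u + ∫ y, h y ∂(T (x, u))) ∧
      (∀ x, ∃ u, c x u + ∫ y, h y ∂(T (x, u)) = ε * ∫ y, h y ∂ρ + h x) ∧
      ∀ S : Set (BoundedContinuousFunction 𝕏 ℝ), IsClosed S → 0 ∈ S →
        (∀ v ∈ S, ∀ w : BoundedContinuousFunction 𝕏 ℝ,
          (∀ x, w x = minorBellman c T ρ ε v x) → w ∈ S) → h ∈ S := by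
  obtain ⟨h, hfix, hS⟩ := exists_minorBellman_fixedPoint hε hc0 hcK hcc hT hm
  refine ⟨h, ?_, fun x u => ?_, fun x => ?_, hS⟩
  · have hK : 0 ≤ K := by
      have := ρ.nonempty_of_neZero
      exact (hc0 (Classical.arbitrary 𝕏) (Classical.arbitrary 𝕌)).trans (hcK _ _)
    refine hS {v | ∀ x, 0 ≤ v x ∧ v x ≤ K / ε} ?_ (fun x => ⟨le_rfl, by simp; positivity⟩) ?_
    · simp only [Set.ofPred_forall, Set.ofPred_and]
      refine isClosed_iInter fun x => IsClosed.inter ?_ ?_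
      · exact isClosed_le continuous_const (continuous_eval_const x)
      · exact isClosed_le (continuous_eval_const x) continuous_const
    · intro v hv w hw x
      rw [hw x]
      obtain ⟨u, hu⟩ := exists_minorBellman_eq (c := c) (T := T) (ρ := ρ) (ε := ε) v x
      have h1 := hm.mul_integral_le hε.le v.continuous.measurable (fun y => (hv y).1)
        (fun y => (hv y).2) (x, u)
      have h2 := hm.integral_sub_le hε.le v.continuous.measurable (fun y => (hv y).1)
        (fun y => (hv y).2) (x, u)
      have h3 : (1 - ε) * (K / ε) = K / ε - K := by field_simp
      rw [hu]
      constructor <;> linarith [hc0 x u, hcK x u]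
  · have := minorBellman_le (c := c) (T := T) (ρ := ρ) (ε := ε) h x u
    rw [hfix x] at this
    linarith
  · obtain ⟨u, hu⟩ := exists_minorBellman_eq (c := c) (T := T) (ρ := ρ) (ε := ε) h x
    rw [hfix x] at hu
    exact ⟨u, by linarith⟩

end FixedPoint

/-! ### Lipschitz regularity from the Wasserstein bound on the kernel. -/

section Wasserstein

variable {𝕏 : Type*} [MetricSpace 𝕏] [MeasurableSpace 𝕏]

/-- Lipschitz functions have integrals that are close for Wasserstein-close measures. -/
theorem abs_integral_sub_le_of_wasserstein1_le [SecondCountableTopology 𝕏] [BorelSpace 𝕏]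
    {μ ν : Measure 𝕏} [IsProbabilityMeasure μ] [IsProbabilityMeasure ν] {v : 𝕏 → ℝ} {L : ℝ≥0}
    (hv : LipschitzWith L v) {K : ℝ} (hK : ∀ x, |v x| ≤ K) {r : ℝ} (hr : 0 ≤ r)
    (h : wasserstein1 μ ν ≤ ENNReal.ofReal r) :
    |∫ x, v x ∂μ - ∫ x, v x ∂ν| ≤ L * r := by
  have hvm : Measurable v := hv.continuous.measurable
  -- The case `L = 0` is separate: the factor is moved inside an infimum whose value at a
  -- non-coupling is `⊤`, and `0 * ⊤ = 0` would spoil this.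
  rcases eq_or_ne L 0 with rfl | hL
  · obtain ⟨x₀⟩ := μ.nonempty_of_neZero
    have hc : v = fun _ => v x₀ := funext fun x => by
      simpa using hv.dist_le_mul x x₀
    rw [hc]
    simp
  suffices h' : ENNReal.ofReal |∫ x, v x ∂μ - ∫ x, v x ∂ν| ≤ L * wasserstein1 μ ν by
    have h2 := h'.trans (mul_le_mul_right h _)
    rw [← ENNReal.ofReal_coe_nnreal, ← ENNReal.ofReal_mul (by positivity)] at h2
    exact (ENNReal.ofReal_le_ofReal_iff (by positivity)).1 h2
  rw [wasserstein1, ENNReal.mul_iInf_of_ne (by simpa using hL) (by simp)]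
  refine le_iInf fun q => ?_
  by_cases hq : q.map Prod.fst = μ ∧ q.map Prod.snd = ν
  · obtain ⟨rfl, rfl⟩ := hq
    have : IsProbabilityMeasure q := Measure.isProbabilityMeasure_of_map Prod.fst
    simp only [and_self, iInf_pos]
    rw [integral_map (by fun_prop) (by fun_prop), integral_map (by fun_prop) (by fun_prop),
      ← integral_sub (integrable_of_abs_le (by fun_prop) fun p => hK _)
        (integrable_of_abs_le (by fun_prop) fun p => hK _),
      ← Real.norm_eq_abs, ofReal_norm, ← lintegral_const_mul' _ _ (by simp)]
    refine (enorm_integral_le_lintegral_enorm _).trans (lintegral_mono fun p => ?_)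
    rw [← edist_eq_enorm_sub]
    exact hv _ _
  · simp [hq, ENNReal.mul_top, hL]

variable {𝕌 : Type*} [TopologicalSpace 𝕌] [MeasurableSpace 𝕌] {c : 𝕏 → 𝕌 → ℝ}
  {T : Kernel (𝕏 × 𝕌) 𝕏} [IsMarkovKernel T] {ρ : Measure 𝕏} {cSup ε : ℝ} {Lc LT : ℝ≥0}

theorem WassersteinRegular.abs_integral_sub_le [SecondCountableTopology 𝕏] [BorelSpace 𝕏]
    (hr : WassersteinRegular c T cSup Lc LT) {v : 𝕏 → ℝ} {L : ℝ≥0} (hv : LipschitzWith L v)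
    {K : ℝ} (hK : ∀ x, |v x| ≤ K) (u : 𝕌) (x y : 𝕏) :
    |∫ z, v z ∂(T (x, u)) - ∫ z, v z ∂(T (y, u))| ≤ L * (LT * dist x y) := by
  refine abs_integral_sub_le_of_wasserstein1_le hv hK (by positivity) ?_
  rw [ENNReal.ofReal_mul (by positivity), ENNReal.ofReal_coe_nnreal, ← edist_dist]
  exact hr.kernel_lipschitz u x y

/-- The dynamic programming operator preserves the Lipschitz functions with a constant `L` such
that `Lc + L * LT ≤ L`. -/
theorem WassersteinRegular.lipschitzWith_minorBellman [SecondCountableTopology 𝕏] [BorelSpace 𝕏]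
    [Fintype 𝕌] [Nonempty 𝕌]
    (hr : WassersteinRegular c T cSup Lc LT) {v : BoundedContinuousFunction 𝕏 ℝ} {L : ℝ≥0}
    (hL : Lc + L * LT ≤ L) (hv : LipschitzWith L v) :
    LipschitzWith L (minorBellman c T ρ ε v) := by
  refine LipschitzWith.of_le_add_mul L fun x y => ?_
  obtain ⟨u, hu⟩ := exists_minorBellman_eq (c := c) (T := T) (ρ := ρ) (ε := ε) v y
  have h1 := minorBellman_le (c := c) (T := T) (ρ := ρ) (ε := ε) v x u
  have h2 := (abs_le.1 (hr.abs_integral_sub_le hv (K := ‖v‖)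
    (fun y => v.norm_coe_le_norm y) u x y)).2
  have h3 := (abs_le.1 ((hr.cost_lipschitz u).dist_le_mul x y)).2
  have h4 : ((Lc : ℝ) + L * LT) * dist x y ≤ L * dist x y :=
    mul_le_mul_of_nonneg_right (by exact_mod_cast hL) dist_nonneg
  linarith

omit [MeasurableSpace 𝕏] in
theorem isClosed_lipschitzWith (L : ℝ≥0) :
    IsClosed {v : BoundedContinuousFunction 𝕏 ℝ | LipschitzWith L v} := by
  simp only [lipschitzWith_iff_dist_le_mul, Set.ofPred_forall]
  exact isClosed_iInter fun x => isClosed_iInter fun y => isClosed_le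
    ((continuous_eval_const x).dist (continuous_eval_const y)) continuous_const

end Wasserstein

/-! ### Where an optimal policy of the finite model satisfies the Bellman equation. -/

section FiniteModelStructure

variable {𝕌 : Type*} [MeasurableSpace 𝕌] [MeasurableSingletonClass 𝕌] [Fintype 𝕌]
  {M : ℕ} {c' : Fin M → 𝕌 → ℝ} {T' : Kernel (Fin M × 𝕌) (Fin M)} [IsMarkovKernel T']
  {ρ' : Measure (Fin M)} [IsProbabilityMeasure ρ'] {K ε : ℝ}

/-- An average cost optimal stationary policy satisfies the optimality equation on a closed set of
states that carries the minorizing measure. -/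
theorem exists_closed_set_of_isAvgOptimal (hε : 0 < ε) (hc0 : ∀ i u, 0 ≤ c' i u)
    (hcK : ∀ i u, c' i u ≤ K) (hm : Minorized T' ρ' ε) {f : Fin M → 𝕌}
    (hf : IsAvgOptimal c' T' f (measurable_of_finite f)) {v : Fin M → ℝ} {g : ℝ}
    (hle : ∀ i u, g + v i ≤ c' i u + ∫ j, v j ∂(T' (i, u)))
    (heq : ∀ i, ∃ u, c' i u + ∫ j, v j ∂(T' (i, u)) = g + v i) :
    ∃ R : Set (Fin M), ρ' Rᶜ = 0 ∧ (∀ i ∈ R, c' i (f i) + ∫ j, v j ∂(T' (i, f i)) = g + v i) ∧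
      ∀ i ∈ R, T' (i, f i) Rᶜ = 0 := by
  have hcK' : ∀ i u, |c' i u| ≤ K := fun i u => by rw [abs_of_nonneg (hc0 i u)]; exact hcK i u
  -- `d` is the nonnegative Bellman defect of `f`, and `e k` is its expectation after `k` steps
  -- under `f`.
  let d : Fin M → ℝ := fun i => c' i (f i) + ∫ j, v j ∂(T' (i, f i)) - (g + v i)
  let A : (Fin M → ℝ) → Fin M → ℝ := fun w i => ∫ j, w j ∂(T' (i, f i))
  let e : ℕ → Fin M → ℝ := fun k => A^[k] d
  have he : ∀ k i, e (k + 1) i = ∫ j, e k j ∂(T' (i, f i)) := fun k i => by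
    simp only [e, Function.iterate_succ_apply']
    rfl
  have he0 : ∀ k i, 0 ≤ e k i := by
    intro k
    induction k with
    | zero => exact fun i => sub_nonneg.2 (hle i (f i))
    | succ k ih => exact fun i => by rw [he]; exact integral_nonneg ih
  have bdd : ∀ w : Fin M → ℝ, ∃ K, ∀ i, |w i| ≤ K := fun w =>
    ⟨∑ i, |w i|, fun i => Finset.single_le_sum (f := fun i => |w i|) (fun _ _ => abs_nonneg _)
      (Finset.mem_univ i)⟩
  have hρ : ∀ k, ∫ j, e k j ∂ρ' = 0 := by
    intro k
    refine le_antisymm (not_lt.1 fun hpos => ?_) (integral_nonneg (he0 k))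
    obtain ⟨x⟩ := ρ'.nonempty_of_neZero
    -- With this corrected potential the sums telescope: cost plus the expectation of `W` equals `g
    -- + W + e (k + 1)`. Minorization gives `e (k + 1) ≥ ε ∫ e k dρ'`, so a positive integral would
    -- force the cost of `f` strictly above `g`, contradicting optimality.
    let W : Fin M → ℝ := fun i => v i + ∑ j ∈ Finset.range (k + 1), e j i
    have hW : ∀ i, ∫ j, W j ∂(T' (i, f i)) =
        ∫ j, v j ∂(T' (i, f i)) + ∑ j ∈ Finset.range (k + 1), e (j + 1) i := by
      intro i
      rw [integral_add Integrable.of_finite Integrable.of_finite,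
        integral_finsetSum _ fun _ _ => Integrable.of_finite]
      simp_rw [he]
    obtain ⟨KW, hKW⟩ := bdd W
    obtain ⟨Kv, hKv⟩ := bdd v
    have h1 : g + ε * ∫ j, e k j ∂ρ' ≤
        avgCost c' T' (Policy.stationary f (measurable_of_finite f)) x := by
      refine le_avgCost_stationary (measurable_of_finite _) hcK' (measurable_of_finite W) hKW _
        (fun i => ?_) x
      obtain ⟨Ke, hKe⟩ := bdd (e k)
      have h2 := hm.mul_integral_le hε.le (measurable_of_finite (e k)) (he0 k)
        (fun i => (le_abs_self _).trans (hKe i)) (i, f i)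
      rw [← he] at h2
      rw [hW]
      have h3 := Finset.sum_range_succ (fun j => e j i) (k + 1)
      have h4 := Finset.sum_range_succ' (fun j => e j i) (k + 1)
      have h5 : e 0 i = c' i (f i) + ∫ j, v j ∂(T' (i, f i)) - (g + v i) := rfl
      simp only [W]
      linarith
    choose s hs using heq
    have h2 : optAvgCost c' T' x ≤ g :=
      (optAvgCost_le hcK' hc0 _ x).trans (avgCost_stationary_le (measurable_of_finite _) hcK'
        (measurable_of_finite v) hKv (measurable_of_finite s) (fun i => (hs i).le) x)
    rw [hf x] at h1
    have := mul_pos hε hpos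
    linarith
  -- The set consists of the states from which no future defect is ever met. It is closed because `e
  -- (k + 1) i = 0` forces `e k` to vanish almost surely at the next state.
  refine ⟨{i | ∀ k, e k i = 0}, ?_, fun i hi => sub_eq_zero.1 (hi 0), fun i hi => ?_⟩
  · refine (ae_all_iff.2 fun k => ?_ : ∀ᵐ i ∂ρ', ∀ k, e k i = 0)
    exact (integral_eq_zero_iff_of_nonneg (he0 k) Integrable.of_finite).1 (hρ k)
  · refine (ae_all_iff.2 fun k => ?_ : ∀ᵐ j ∂(T' (i, f i)), ∀ k, e k j = 0)
    exact (integral_eq_zero_iff_of_nonneg (he0 k) Integrable.of_finite).1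
      (by rw [← he]; exact hi (k + 1))

end FiniteModelStructure

/-! ### From near-equality of the one-step operators to a regret bound. -/

section Transfer

variable {𝕏 𝕌 : Type*} [MeasurableSpace 𝕏] [MeasurableSpace 𝕌]
  [Fintype 𝕌] {M : ℕ} {c : 𝕏 → 𝕌 → ℝ} {T : Kernel (𝕏 × 𝕌) 𝕏} [IsMarkovKernel T]
  {c' : Fin M → 𝕌 → ℝ} {T' : Kernel (Fin M × 𝕌) (Fin M)} [IsMarkovKernel T']
  {ρ π : Measure 𝕏} [IsProbabilityMeasure ρ] {K Kh ε Δ Δ₀ : ℝ}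

omit [IsMarkovKernel T] in
/-- Every null set is contained in a null set that cannot be entered from outside. -/
theorem exists_null_superset_not_entered
    (hnull : ∀ E, MeasurableSet E → π E = 0 → ∀ u, ∀ᵐ x ∂π, T (x, u) E = 0)
    {E₀ : Set 𝕏} (hE₀ : MeasurableSet E₀) (h0 : π E₀ = 0) :
    ∃ E, E₀ ⊆ E ∧ MeasurableSet E ∧ π E = 0 ∧ ∀ x ∉ E, ∀ u, T (x, u) E = 0 := by
  -- `F s` is the set of states that can enter `s` in one step. Its iterates stay null, and their
  -- union is closed under taking such predecessors.
  let F : Set 𝕏 → Set 𝕏 := fun s => ⋃ u, {x | T (x, u) s ≠ 0}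
  have hF : ∀ k, MeasurableSet (F^[k] E₀) ∧ π (F^[k] E₀) = 0 := by
    intro k
    induction k with
    | zero => exact ⟨hE₀, h0⟩
    | succ k ih =>
      rw [Function.iterate_succ_apply']
      refine ⟨MeasurableSet.iUnion fun u => ?_, measure_iUnion_null fun u => ?_⟩
      · exact ((T.measurable_coe ih.1).comp measurable_prodMk_right)
          (measurableSet_singleton 0).compl
      · exact ae_iff.1 (hnull _ ih.1 ih.2 u)
  refine ⟨⋃ k, F^[k] E₀, Set.subset_iUnion (fun k => F^[k] E₀) 0,
    MeasurableSet.iUnion fun k => (hF k).1, measure_iUnion_null fun k => (hF k).2,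
    fun x hx u => measure_iUnion_null fun k => ?_⟩
  by_contra hne
  refine hx (Set.mem_iUnion.2 ⟨k + 1, ?_⟩)
  rw [Function.iterate_succ_apply']
  exact Set.mem_iUnion.2 ⟨u, hne⟩

omit [Fintype 𝕌] [IsMarkovKernel T] in
/-- Two solutions of optimality equations are close if one almost solves the equation of the
other. -/
theorem abs_sub_le_of_averageCost_solutions (B : StatePartition 𝕏 M)
    (hne : ∀ i, ∃ x, B.index x = i) (hε : 0 < ε) (hε1 : ε ≤ 1)
    (hm' : Minorized T' (ρ.map B.index) ε) {h : 𝕏 → ℝ}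
    (hmeas : Measurable h) (hK : ∀ x, |h x| ≤ Kh)
    (hle : ∀ x u, ε * ∫ y, h y ∂ρ + h x ≤ c x u + ∫ y, h y ∂(T (x, u)))
    (heq : ∀ x, ∃ u, c x u + ∫ y, h y ∂(T (x, u)) = ε * ∫ y, h y ∂ρ + h x)
    {hM : Fin M → ℝ} (hΔ₀ : ∀ x, |hM (B.index x) - h x| ≤ Δ₀)
    (hΔ : ∀ x u, |c' (B.index x) u + ∫ j, hM j ∂(T' (B.index x, u)) -
      (c x u + ∫ y, h y ∂(T (x, u)))| ≤ Δ)
    {v : Fin M → ℝ}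
    (hle' : ∀ i u, ε * ∫ j, v j ∂(ρ.map B.index) + v i ≤ c' i u + ∫ j, v j ∂(T' (i, u)))
    (heq' : ∀ i, ∃ u, c' i u + ∫ j, v j ∂(T' (i, u)) =
      ε * ∫ j, v j ∂(ρ.map B.index) + v i) :
    |∫ j, hM j ∂(ρ.map B.index) - ∫ x, h x ∂ρ| ≤ Δ₀ ∧
      ∀ i, |v i - hM i| ≤ (Δ + 2 * Δ₀) / ε := by
  have hprob : IsProbabilityMeasure (ρ.map B.index) :=
    Measure.isProbabilityMeasure_map B.measurable_index.aemeasurable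
  have hρ : |∫ j, hM j ∂(ρ.map B.index) - ∫ x, h x ∂ρ| ≤ Δ₀ := by
    have hint : Integrable (fun x => hM (B.index x)) ρ :=
      (Integrable.of_finite (μ := ρ.map B.index)).comp_measurable B.measurable_index
    rw [integral_map B.measurable_index.aemeasurable (measurable_of_finite _).aestronglyMeasurable,
      ← integral_sub hint (integrable_of_abs_le hmeas hK)]
    exact abs_integral_le_of_abs_le hΔ₀
  refine ⟨hρ, ?_⟩
  obtain ⟨x₀⟩ := ρ.nonempty_of_neZero
  have : Nonempty (Fin M) := ⟨B.index x₀⟩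
  obtain ⟨i₀, hi₀⟩ := Finite.exists_max (fun i => |v i - hM i|)
  have hΔ₀0 : 0 ≤ Δ₀ := (abs_nonneg _).trans (hΔ₀ x₀)
  have hεΔ : ε * Δ₀ ≤ Δ₀ := by nlinarith
  have hρ1 := mul_le_mul_of_nonneg_left (abs_le.1 hρ).1 hε.le
  have hρ2 := mul_le_mul_of_nonneg_left (abs_le.1 hρ).2 hε.le
  have hb : ∀ u i, ∫ j, v j ∂(T' (i, u)) - ∫ j, hM j ∂(T' (i, u)) -
      ε * (∫ j, v j ∂(ρ.map B.index) - ∫ j, hM j ∂(ρ.map B.index)) ≤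
        (1 - ε) * |v i₀ - hM i₀| := by
    intro u i
    have := hm'.integral_sub_le hε.le (measurable_of_finite (fun j => v j - hM j))
      (fun j => (abs_le.1 (hi₀ j)).1) (fun j => (abs_le.1 (hi₀ j)).2) (i, u)
    rwa [integral_sub Integrable.of_finite Integrable.of_finite,
      integral_sub Integrable.of_finite Integrable.of_finite] at this
  have hb' : ∀ u i, ∫ j, hM j ∂(T' (i, u)) - ∫ j, v j ∂(T' (i, u)) -
      ε * (∫ j, hM j ∂(ρ.map B.index) - ∫ j, v j ∂(ρ.map B.index)) ≤
        (1 - ε) * |v i₀ - hM i₀| := by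
    intro u i
    have := hm'.integral_sub_le hε.le (measurable_of_finite (fun j => hM j - v j))
      (fun j => by linarith [(abs_le.1 (hi₀ j)).2]) (b := |v i₀ - hM i₀|)
      (fun j => by linarith [(abs_le.1 (hi₀ j)).1]) (i, u) (a := -|v i₀ - hM i₀|)
    rwa [integral_sub Integrable.of_finite Integrable.of_finite,
      integral_sub Integrable.of_finite Integrable.of_finite] at this
  -- Playing the minimizing action of either equation in the other compares `v` with `hM`; the
  -- minorization contracts their largest gap, attained at `i₀`. One `Δ₀` comes from replacing `h`
  -- by `hM` at the state, the other from the gain.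
  have hkey : ∀ i, |v i - hM i| ≤ (1 - ε) * |v i₀ - hM i₀| + (Δ + 2 * Δ₀) := by
    intro i
    obtain ⟨x, rfl⟩ := hne i
    have h0 := abs_le.1 (hΔ₀ x)
    rw [abs_le]
    constructor
    · obtain ⟨u, hu⟩ := heq' (B.index x)
      have h1 := hle x u
      have h2 := abs_le.1 (hΔ x u)
      have h3 := hb' u (B.index x)
      linarith
    · obtain ⟨u, hu⟩ := heq x
      have h1 := hle' (B.index x) u
      have h2 := abs_le.1 (hΔ x u)
      have h3 := hb u (B.index x)
      linarith
  have hfin : |v i₀ - hM i₀| ≤ (Δ + 2 * Δ₀) / ε := by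
    rw [le_div_iff₀ hε]
    linarith [hkey i₀]
  exact fun i => (hi₀ i).trans hfin

/-- Performance, in the original model, of an optimal policy of a finite model whose one-step
operator is close to the original one at the solution of the optimality equation. -/
theorem abs_avgCost_extendPolicy_sub_le [Nonempty 𝕌] [MeasurableSingletonClass 𝕌]
    (B : StatePartition 𝕏 M)
    (hne : ∀ i, ∃ x, B.index x = i) (hε : 0 < ε) (hc : Measurable (Function.uncurry c))
    (hc0 : ∀ x u, 0 ≤ c x u) (hcK : ∀ x u, c x u ≤ K)
    (hc0' : ∀ i u, 0 ≤ c' i u) (hcK' : ∀ i u, c' i u ≤ K)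
    (hm : Minorized T ρ ε) (hm' : Minorized T' (ρ.map B.index) ε) {h : 𝕏 → ℝ}
    (hmeas : Measurable h) (hK : ∀ x, |h x| ≤ Kh)
    (hle : ∀ x u, ε * ∫ y, h y ∂ρ + h x ≤ c x u + ∫ y, h y ∂(T (x, u)))
    (heq : ∀ x, ∃ u, c x u + ∫ y, h y ∂(T (x, u)) = ε * ∫ y, h y ∂ρ + h x)
    {hM : Fin M → ℝ} (hΔ₀ : ∀ x, |hM (B.index x) - h x| ≤ Δ₀)
    (hΔ : ∀ x u, |c' (B.index x) u + ∫ j, hM j ∂(T' (B.index x, u)) -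
      (c x u + ∫ y, h y ∂(T (x, u)))| ≤ Δ)
    (hρπ : ρ ≪ π) (hnull : ∀ E, MeasurableSet E → π E = 0 → ∀ u, ∀ᵐ x ∂π, T (x, u) E = 0)
    (hsupp : ∀ i u j, T' (i, u) {j} = 0 → ∀ᵐ x ∂π, x ∈ B.bin i → T (x, u) (B.bin j) = 0)
    {f : Fin M → 𝕌} (hf : IsAvgOptimal c' T' f (measurable_of_finite f)) (x : 𝕏) :
    |avgCost c T (extendPolicy B f) x - optAvgCost c T x| ≤ 4 * (Δ + 2 * Δ₀) / ε := by
  have hε1 : ε ≤ 1 := hm.le_one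
  have hcK1 : ∀ x u, |c x u| ≤ K := fun i u => by rw [abs_of_nonneg (hc0 i u)]; exact hcK i u
  have hprob : IsProbabilityMeasure (ρ.map B.index) :=
    Measure.isProbabilityMeasure_map B.measurable_index.aemeasurable
  obtain ⟨v, -, hle', heq', -⟩ := exists_averageCost_solution (c := c') (T := T')
    (ρ := ρ.map B.index) hε hc0' hcK' (fun u => continuous_of_discreteTopology)
    (fun u v => continuous_of_discreteTopology) hm'
  obtain ⟨hρM, hD⟩ := abs_sub_le_of_averageCost_solutions B hne hε hε1 hm' hmeas hK hle heq hΔ₀ hΔ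
    hle' heq'
  obtain ⟨R, hR0, hReq, hRcl⟩ := exists_closed_set_of_isAvgOptimal hε hc0' hcK' hm' hf hle' heq'
  set D := (Δ + 2 * Δ₀) / ε with hDdef
  have hΔ00 : 0 ≤ Δ₀ := (abs_nonneg _).trans (hΔ₀ x)
  have hΔ0 : 0 ≤ Δ := (abs_nonneg _).trans (hΔ x (Classical.arbitrary 𝕌))
  have hDε : Δ + 2 * Δ₀ ≤ D := by
    rw [hDdef, le_div_iff₀ hε]
    nlinarith
  have hopt : ε * ∫ y, h y ∂ρ ≤ optAvgCost c T x := le_optAvgCost hc hcK1 hmeas hK hle x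
  suffices hup : avgCost c T (extendPolicy B f) x ≤ ε * ∫ y, h y ∂ρ + 4 * D by
    have := optAvgCost_le (T := T) hcK1 hc0 (extendPolicy B f) x
    rw [abs_of_nonneg (by linarith), mul_div_assoc, ← hDdef]
    linarith
  -- the bins of the closed set, up to a null set, form an absorbing set
  let F : 𝕏 → 𝕌 := fun x => f (B.index x)
  have hFm : Measurable F := (measurable_of_finite f).comp B.measurable_index
  have hRm : MeasurableSet (B.index ⁻¹' R) := B.measurable_index (Set.toFinite R).measurableSet
  have hE₀m : MeasurableSet {x | x ∈ B.index ⁻¹' R ∧ T (x, F x) (B.index ⁻¹' R)ᶜ ≠ 0} :=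
    hRm.inter (((T.measurable_coe hRm.compl).comp (measurable_id.prodMk hFm))
      (measurableSet_singleton 0).compl)
  -- A zero entry of `T'` forces the true transition between the two bins to vanish almost
  -- everywhere, so closedness of `R` passes to `T` off a `π`-null set.
  have hE₀ : π {x | x ∈ B.index ⁻¹' R ∧ T (x, F x) (B.index ⁻¹' R)ᶜ ≠ 0} = 0 := by
    have hall : ∀ᵐ x ∂π, ∀ i u j, T' (i, u) {j} = 0 → x ∈ B.bin i → T (x, u) (B.bin j) = 0 := by
      simp only [ae_all_iff]
      exact hsupp
    refine measure_mono_null ?_ hall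
    rintro x ⟨hxR, hxT⟩ hx
    refine hxT ?_
    have hcover : (B.index ⁻¹' R)ᶜ ⊆ ⋃ j : (Rᶜ : Set (Fin M)), B.bin j := fun y hy =>
      Set.mem_iUnion.2 ⟨⟨B.index y, hy⟩, B.mem_bin_index y⟩
    refine measure_mono_null hcover (measure_iUnion_null fun j => ?_)
    exact hx (B.index x) (F x) j
      (measure_mono_null (Set.singleton_subset_iff.2 j.2) (hRcl _ hxR)) (B.mem_bin_index x)
  obtain ⟨E, hE₀E, hEm, hE0, hEcl⟩ := exists_null_superset_not_entered hnull hE₀m hE₀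
  set G : Set 𝕏 := B.index ⁻¹' R \ E with hG
  have hGm : MeasurableSet G := hRm.diff hEm
  have hGc : Gᶜ = (B.index ⁻¹' R)ᶜ ∪ E := by
    rw [hG, Set.sdiff_eq, Set.compl_inter, compl_compl]
  have hGρ : ρ Gᶜ = 0 := by
    rw [hGc]
    refine measure_union_null ?_ (hρπ hE0)
    rwa [Measure.map_apply B.measurable_index (Set.toFinite _).measurableSet] at hR0
  have hGT : ∀ x ∈ G, T (x, F x) Gᶜ = 0 := by
    intro x hx
    rw [hGc]
    refine measure_union_null ?_ (hEcl x hx.2 _)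
    by_contra hne
    exact hx.2 (hE₀E ⟨hx.1, hne⟩)
  have hGT' : ∀ x, (T (x, F x)).real Gᶜ ≤ 1 - ε := by
    intro x
    have h1 : (T (x, F x)).real Gᶜ = 1 - (T (x, F x)).real G := probReal_compl_eq_one_sub hGm
    have h2 : ρ G = 1 := (prob_compl_eq_zero_iff hGm).1 hGρ
    have h3 := hm x (F x) G hGm
    rw [h2, mul_one, ← ofReal_measureReal, ENNReal.ofReal_le_ofReal_iff measureReal_nonneg] at h3
    linarith
  have hKh : 0 ≤ Kh := (abs_nonneg _).trans (hK x)
  have hK0 : 0 ≤ K := (hc0 x (F x)).trans (hcK _ _)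
  -- Outside `G` the penalty falls by at least `Q * ε` in expectation, because `G` is entered with
  -- probability at least `ε`. This pays for the cost (`K`), the next value of `h`, its current
  -- value and the gain (`Kh` each).
  set Q := (K + 3 * Kh) / ε with hQ
  have hQ0 : 0 ≤ Q := by positivity
  have hQε : Q * ε = K + 3 * Kh := by rw [hQ]; field_simp
  have hwint : ∀ x, ∫ y, (h y + Gᶜ.indicator (fun _ => Q) y) ∂(T (x, F x)) =
      ∫ y, h y ∂(T (x, F x)) + Q * (T (x, F x)).real Gᶜ := by
    intro x
    rw [integral_add (integrable_of_abs_le hmeas hK)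
      ((integrable_const Q).indicator hGm.compl), integral_indicator_const _ hGm.compl,
      smul_eq_mul, mul_comm]
  refine avgCost_stationary_le (v := fun y => h y + Gᶜ.indicator (fun _ => Q) y)
    (Kv := Kh + Q) hc hcK1 (hmeas.add (measurable_const.indicator hGm.compl)) (fun y => ?_)
    hFm (fun y => ?_) x
  · refine (abs_add_le _ _).trans (add_le_add (hK y) ?_)
    rw [abs_of_nonneg (Set.indicator_nonneg (fun _ _ => hQ0) y)]
    exact Set.indicator_le_self' (fun _ _ => hQ0) y
  · rw [hwint]
    -- On `G` the penalty is never incurred, and the errors add up to `3 * D + Δ + 2 * Δ₀`, hence at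
    -- most `4 * D`.
    by_cases hy : y ∈ G
    · have h1 : (T (y, F y)).real Gᶜ = 0 := by simp [Measure.real, hGT y hy]
      have h2 := hReq (B.index y) hy.1
      have h3 := abs_le.1 (hΔ y (F y))
      have h4 := abs_le.1 (hΔ₀ y)
      have h5 := abs_le.1 (hD (B.index y))
      have h6 : ∫ j, (hM j - v j) ∂(T' (B.index y, F y)) ≤ D :=
        (abs_le.1 (abs_integral_le_of_abs_le fun j => by rw [abs_sub_comm]; exact hD j)).2
      have h7 : ∫ j, (v j - hM j) ∂(ρ.map B.index) ≤ D :=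
        (abs_le.1 (abs_integral_le_of_abs_le hD)).2
      rw [integral_sub Integrable.of_finite Integrable.of_finite] at h6 h7
      have h8 : ε * (∫ j, v j ∂(ρ.map B.index) - ∫ y, h y ∂ρ) ≤ D + Δ₀ := by
        have h9 := (abs_le.1 hρM).2
        have h10 : 0 ≤ D + Δ₀ := by linarith
        calc _ ≤ ε * (D + Δ₀) := by gcongr; linarith
          _ ≤ 1 * (D + Δ₀) := by gcongr
          _ = _ := one_mul _
      simp only [h1, Set.indicator_of_notMem (Set.notMem_compl_iff.2 hy)]
      change c' (B.index y) (F y) + _ = _ at h2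
      linarith
    · have h1 : ∫ z, h z ∂(T (y, F y)) ≤ Kh := (abs_le.1 (abs_integral_le_of_abs_le hK)).2
      have h2 : -Kh ≤ ε * ∫ z, h z ∂ρ := by
        have := (abs_le.1 (abs_integral_le_of_abs_le (μ := ρ) hK)).1
        nlinarith
      have h3 := (abs_le.1 (hK y)).1
      have h4 : Q * (T (y, F y)).real Gᶜ ≤ Q * (1 - ε) := by gcongr; exact hGT' y
      rw [Set.indicator_of_mem (Set.mem_compl hy)]
      have h5 := hcK y (F y)
      linarith

end Transfer

/-! ### Invariance of `π` and its null sets. -/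

section Stationarity

variable {𝕏 𝕌 : Type*} [MeasurableSpace 𝕏] [MeasurableSpace 𝕌] {T : Kernel (𝕏 × 𝕌) 𝕏}
  [IsMarkovKernel T] {γ : Measure 𝕌} [IsProbabilityMeasure γ] {π ρ : Measure 𝕏}
  [IsProbabilityMeasure π] {ε : ℝ}

/-- If `tripleLaw T γ π` is invariant for the augmented chain, then `π` is invariant for the state
chain. -/
theorem lintegral_eq_of_invariant (h : Kernel.Invariant (tripleKernel T γ) (tripleLaw T γ π))
    {A : Set 𝕏} (hA : MeasurableSet A) : ∫⁻ p, T p A ∂(π.prod γ) = π A := by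
  have hA1 : MeasurableSet (Prod.fst ⁻¹' A : Set (𝕏 × 𝕌 × 𝕏)) := measurable_fst hA
  have hA2 : MeasurableSet ((fun z : 𝕏 × 𝕌 × 𝕏 => z.2.2) ⁻¹' A) :=
    (measurable_snd.comp measurable_snd) hA
  have h1 : tripleLaw T γ π (Prod.fst ⁻¹' A) = π A := by
    rw [tripleLaw, Measure.map_apply (MeasurableEquiv.measurable _) hA1]
    have : (MeasurableEquiv.prodAssoc : (𝕏 × 𝕌) × 𝕏 ≃ᵐ 𝕏 × 𝕌 × 𝕏) ⁻¹' (Prod.fst ⁻¹' A) =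
        (A ×ˢ Set.univ) ×ˢ Set.univ := by
      ext p
      simp [MeasurableEquiv.prodAssoc]
    rw [this, Measure.compProd_apply_prod (hA.prod .univ) .univ]
    simp
  have h2 : tripleLaw T γ π ((fun z => z.2.2) ⁻¹' A) = ∫⁻ p, T p A ∂(π.prod γ) := by
    rw [tripleLaw, Measure.map_apply (MeasurableEquiv.measurable _) hA2]
    have : (MeasurableEquiv.prodAssoc : (𝕏 × 𝕌) × 𝕏 ≃ᵐ 𝕏 × 𝕌 × 𝕏) ⁻¹'
        ((fun z => z.2.2) ⁻¹' A) = Set.univ ×ˢ A := by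
      ext p
      simp [MeasurableEquiv.prodAssoc]
    rw [this, Measure.compProd_apply_prod .univ hA]
    simp
  -- One step copies the third coordinate into the first, so invariance equates the first and third
  -- marginals of `tripleLaw T γ π`.
  have h3 : ∀ z, tripleKernel T γ z (Prod.fst ⁻¹' A) =
      ((fun z : 𝕏 × 𝕌 × 𝕏 => z.2.2) ⁻¹' A).indicator 1 z := by
    intro z
    rw [tripleKernel, Kernel.comap_apply,
      Kernel.map_apply' _ (MeasurableEquiv.measurable _) _ hA1]
    have : (MeasurableEquiv.prodAssoc : (𝕏 × 𝕌) × 𝕏 ≃ᵐ 𝕏 × 𝕌 × 𝕏) ⁻¹' (Prod.fst ⁻¹' A) =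
        (A ×ˢ Set.univ) ×ˢ Set.univ := by
      ext p
      simp [MeasurableEquiv.prodAssoc]
    rw [this, Kernel.compProd_apply_prod (hA.prod .univ) .univ]
    simp only [Kernel.prodMkLeft_apply, measure_univ, lintegral_const, one_mul,
      Measure.restrict_apply_univ]
    rw [Kernel.prod_apply, Measure.prod_prod]
    simp [Kernel.id_apply, Measure.dirac_apply' _ hA, Set.indicator]
    rfl
  rw [← h1, ← h2, ← h.def, Measure.bind_apply hA1 (Kernel.aemeasurable _), h.def]
  simp_rw [h3]
  rw [lintegral_indicator_one hA2]

/-- Being an average of transition laws, `π` dominates `ε ρ`. -/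
theorem absolutelyContinuous_of_invariant (hε : 0 < ε) (hm : Minorized T ρ ε)
    (h : Kernel.Invariant (tripleKernel T γ) (tripleLaw T γ π)) : ρ ≪ π := by
  refine Measure.AbsolutelyContinuous.mk fun A hA h0 => ?_
  have h1 : ENNReal.ofReal ε * ρ A ≤ ∫⁻ p, T p A ∂(π.prod γ) := by
    calc ENNReal.ofReal ε * ρ A = ∫⁻ p, ENNReal.ofReal ε * ρ A ∂(π.prod γ) := by simp
      _ ≤ _ := lintegral_mono fun p => hm p.1 p.2 A hA
  rw [lintegral_eq_of_invariant h hA, h0, nonpos_iff_eq_zero, mul_eq_zero] at h1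
  exact h1.resolve_left (by simpa using hε)

/-- By invariance a null set has zero average transition probability under `π ⊗ γ`; since `γ`
charges every action, this holds action by action. -/
theorem ae_kernel_eq_zero_of_invariant [Countable 𝕌] [MeasurableSingletonClass 𝕌]
    (hγ : ∀ u, 0 < γ {u})
    (h : Kernel.Invariant (tripleKernel T γ) (tripleLaw T γ π)) {E : Set 𝕏}
    (hE : MeasurableSet E) (h0 : π E = 0) (u : 𝕌) : ∀ᵐ x ∂π, T (x, u) E = 0 := by
  have h1 := lintegral_eq_of_invariant h hE
  rw [h0, lintegral_eq_zero_iff (T.measurable_coe hE)] at h1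
  have h2 := Measure.ae_ae_of_ae_prod h1
  filter_upwards [h2] with x hx
  exact (ae_iff_of_countable.1 hx) u (hγ u).ne'

end Stationarity

/-! ### Averages over visits to a bin-action cell and their concentration. -/

section Cells

variable {𝕏 𝕌 : Type*} [MeasurableSpace 𝕏] [MeasurableSpace 𝕌] {M : ℕ}

/-- Sum over the visits to a cell, divided by the number of steps. -/
noncomputable def cellAvg (B : StatePartition 𝕏 M) (N : ℕ) (xs : ℕ → 𝕏) (us : ℕ → 𝕌) (i : Fin M)
    (u : 𝕌) (ψ : 𝕏 → 𝕏 → ℝ) : ℝ :=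
  (N : ℝ)⁻¹ * ∑ n ∈ visits B N xs us i u, ψ (xs n) (xs (n + 1))

/-- The stationary mean corresponding to `cellAvg`. -/
noncomputable def cellMean (B : StatePartition 𝕏 M) (T : Kernel (𝕏 × 𝕌) 𝕏) (γ : Measure 𝕌)
    (π : Measure 𝕏) (i : Fin M) (u : 𝕌) (ψ : 𝕏 → 𝕏 → ℝ) : ℝ :=
  γ.real {u} * ∫ x in B.bin i, ∫ x', ψ x x' ∂(T (x, u)) ∂π

open Classical in
/-- The function on triples whose averages are `cellAvg`. -/
noncomputable def cellFun (B : StatePartition 𝕏 M) (i : Fin M) (u : 𝕌) (ψ : 𝕏 → 𝕏 → ℝ)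
    (z : 𝕏 × 𝕌 × 𝕏) : ℝ :=
  if z.1 ∈ B.bin i ∧ z.2.1 = u then ψ z.1 z.2.2 else 0

variable (B : StatePartition 𝕏 M) (i : Fin M) (u : 𝕌) {ψ : 𝕏 → 𝕏 → ℝ}

theorem measurable_cellFun [MeasurableSingletonClass 𝕌]
    (hψ : Measurable (Function.uncurry ψ)) : Measurable (cellFun B i u ψ) := by
  classical
  refine Measurable.ite ?_ (hψ.comp (measurable_fst.prodMk (measurable_snd.comp measurable_snd)))
    measurable_const
  exact (measurable_fst (B.measurableSet_bin i)).inter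
    ((measurable_fst.comp measurable_snd) (measurableSet_singleton u))

omit [MeasurableSpace 𝕌] in
theorem sum_cellFun (N : ℕ) (xs : ℕ → 𝕏) (us : ℕ → 𝕌) :
    (N : ℝ)⁻¹ * ∑ t ∈ Finset.range N, cellFun B i u ψ (xs t, us t, xs (t + 1)) =
      cellAvg B N xs us i u ψ := by
  classical
  unfold cellAvg visits cellFun
  rw [Finset.sum_filter]

theorem integral_cellFun [Fintype 𝕌] (T : Kernel (𝕏 × 𝕌) 𝕏) (γ : Measure 𝕌) (π : Measure 𝕏) :
    ∫ x, ∑ u', (∫ x', cellFun B i u ψ (x, u', x') ∂(T (x, u'))) * γ.real {u'} ∂π =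
      cellMean B T γ π i u ψ := by
  classical
  unfold cellMean
  rw [← integral_const_mul, ← integral_indicator (B.measurableSet_bin i)]
  refine integral_congr_ae (Filter.Eventually.of_forall fun x => ?_)
  simp only
  rw [Finset.sum_eq_single u]
  · by_cases hx : x ∈ B.bin i
    · simp [cellFun, hx, mul_comm]
    · simp [cellFun, hx]
  · intro u' _ hu'
    simp [cellFun, hu']
  · simp

variable {Ω : Type*} [MeasurableSpace Ω] {P : Measure Ω} {T : Kernel (𝕏 × 𝕌) 𝕏} {γ : Measure 𝕌}
  {π : Measure 𝕏} {X : ℕ → Ω → 𝕏} {U : ℕ → Ω → 𝕌} {C₀ c₀ : ℝ}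

theorem measurable_cellAvg [MeasurableSingletonClass 𝕌] (hX : ∀ n, Measurable (X n))
    (hU : ∀ n, Measurable (U n)) (hψ : Measurable (Function.uncurry ψ)) (N : ℕ) :
    Measurable (fun ω => cellAvg B N (fun n => X n ω) (fun n => U n ω) i u ψ) := by
  simp_rw [← sum_cellFun]
  refine measurable_const.mul (Finset.measurable_fun_sum _ fun t _ => ?_)
  exact (measurable_cellFun B i u hψ).comp ((hX t).prodMk ((hU t).prodMk (hX (t + 1))))

theorem ErgodicConcentration.cellAvg [Fintype 𝕌] [MeasurableSingletonClass 𝕌]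
    (h : ErgodicConcentration T γ π P X U C₀ c₀)
    (hψ : Measurable (Function.uncurry ψ)) (h0 : ∀ x y, 0 ≤ ψ x y) (h1 : ∀ x y, ψ x y ≤ 1)
    {η : ℝ} (hη : 0 < η) {N : ℕ} (hN : 1 ≤ N) :
    P.real {ω | η ≤ |MDP.cellAvg B N (fun n => X n ω) (fun n => U n ω) i u ψ
      - cellMean B T γ π i u ψ|} ≤ C₀ * Real.exp (-(c₀ * N * η ^ 2)) := by
  have := h.concentration (cellFun B i u ψ) (measurable_cellFun B i u hψ) (fun z => by
    unfold cellFun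
    split_ifs
    · exact ⟨h0 _ _, h1 _ _⟩
    · simp) η hη N hN
  rw [integral_cellFun] at this
  simpa only [sum_cellFun B i u _ (fun n => X n _) (fun n => U n _)] using this

end Cells

/-! ### The empirical model as ratios of cell averages. -/

section Empirical

variable {𝕏 𝕌 : Type*} [MeasurableSpace 𝕏] [MeasurableSpace 𝕌] {M N : ℕ}
  (B : StatePartition 𝕏 M) {xs : ℕ → 𝕏} {us : ℕ → 𝕌} {i : Fin M} {u : 𝕌}

theorem empKernel_singleton [Finite 𝕌] [MeasurableSingletonClass 𝕌] (j : Fin M) :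
    empKernel B N xs us (i, u) {j} = ENNReal.ofReal (empTransition B N xs us i u j) := by
  change (empPMF B N xs us i u).toMeasure {j} = _
  rw [PMF.toMeasure_apply_singleton _ _ (measurableSet_singleton j)]
  rfl

theorem integral_empKernel [Finite 𝕌] [MeasurableSingletonClass 𝕌] (w : Fin M → ℝ) :
    ∫ j, w j ∂(empKernel B N xs us (i, u)) = ∑ j, empTransition B N xs us i u j * w j := by
  rw [integral_fintype Integrable.of_finite]
  refine Finset.sum_congr rfl fun j _ => ?_
  rw [Measure.real, empKernel_singleton, ENNReal.toReal_ofReal (empTransition_nonneg ..),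
    smul_eq_mul]

omit [MeasurableSpace 𝕌] in
theorem cellAvg_one : cellAvg B N xs us i u (fun _ _ => 1) =
    (N : ℝ)⁻¹ * (visits B N xs us i u).card := by
  simp [cellAvg]

omit [MeasurableSpace 𝕌] in
theorem empTransition_eq_div (hN : 1 ≤ N) (hv : (visits B N xs us i u).card ≠ 0) (j : Fin M) :
    empTransition B N xs us i u j =
      cellAvg B N xs us i u (fun _ y => (B.bin j).indicator 1 y) /
        cellAvg B N xs us i u (fun _ _ => 1) := by
  classical
  have hN' : (N : ℝ) ≠ 0 := by positivity
  rw [cellAvg_one, cellAvg, empTransition, if_neg hv, mul_div_mul_left _ _ (inv_ne_zero hN')]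
  congr 1
  simp [Set.indicator_apply]

/-- The empirical one-step operator as a ratio of averages. -/
theorem empCost_add_integral_eq_div [Finite 𝕌] [MeasurableSingletonClass 𝕌] (hN : 1 ≤ N)
    (hv : (visits B N xs us i u).card ≠ 0)
    (c : 𝕏 → 𝕌 → ℝ) (w : Fin M → ℝ) :
    empCost B c N xs us i u + ∫ j, w j ∂(empKernel B N xs us (i, u)) =
      cellAvg B N xs us i u (fun x y => c x u + w (B.index y)) /
        cellAvg B N xs us i u (fun _ _ => 1) := by
  classical
  have hN' : (N : ℝ) ≠ 0 := by positivity
  have h1 : ∑ j, empTransition B N xs us i u j * w j =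
      (∑ n ∈ visits B N xs us i u, w (B.index (xs (n + 1)))) / (visits B N xs us i u).card := by
    rw [Finset.sum_div, ← Finset.sum_fiberwise (visits B N xs us i u)
      (fun n => B.index (xs (n + 1)))]
    refine Finset.sum_congr rfl fun j _ => ?_
    rw [empTransition, if_neg hv, div_mul_eq_mul_div, ← Finset.sum_div]
    congr 1
    rw [Finset.sum_congr rfl (g := fun _ => w j) (fun n hn => by rw [(Finset.mem_filter.1 hn).2]),
      Finset.sum_const, nsmul_eq_mul]
    simp only [B.index_eq_iff]
  rw [integral_empKernel, h1, empCost, if_neg hv, cellAvg_one, cellAvg,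
    mul_div_mul_left _ _ (inv_ne_zero hN'), ← add_div, Finset.sum_add_distrib]
  congr 2
  refine Finset.sum_congr rfl fun n hn => ?_
  rw [visits, Finset.mem_filter] at hn
  rw [hn.2.2]

omit [MeasurableSpace 𝕌] in
theorem empCost_nonneg {c : 𝕏 → 𝕌 → ℝ} (hc : ∀ x u, 0 ≤ c x u) :
    0 ≤ empCost B c N xs us i u := by
  unfold empCost
  split_ifs
  · exact le_rfl
  · exact div_nonneg (Finset.sum_nonneg fun _ _ => hc _ _) (by positivity)

omit [MeasurableSpace 𝕌] in
theorem empCost_le {c : 𝕏 → 𝕌 → ℝ} {K : ℝ} (hK : 0 ≤ K) (hc : ∀ x u, c x u ≤ K) :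
    empCost B c N xs us i u ≤ K := by
  unfold empCost
  split_ifs with h
  · exact hK
  · have : (0 : ℝ) < (visits B N xs us i u).card := by exact_mod_cast Nat.pos_of_ne_zero h
    rw [div_le_iff₀ this]
    exact (Finset.sum_le_card_nsmul _ _ K fun _ _ => hc _ _).trans (by rw [nsmul_eq_mul, mul_comm])

theorem minorized_of_singleton {T' : Kernel (Fin M × 𝕌) (Fin M)} {ρ' : Measure (Fin M)} {ε : ℝ}
    (h : ∀ i u j, ENNReal.ofReal ε * ρ' {j} ≤ T' (i, u) {j}) : Minorized T' ρ' ε := by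
  classical
  intro i u A _
  rw [← Set.coe_toFinset A, ← sum_measure_singleton, ← sum_measure_singleton, Finset.mul_sum]
  exact Finset.sum_le_sum fun j _ => h i u j

end Empirical

/-! ### The constants `kappaPi` and `kappaT`. -/

section Kappa

variable {𝕏 𝕌 : Type*} [MeasurableSpace 𝕏] [MeasurableSpace 𝕌] [Fintype 𝕌] {M : ℕ}
  (B : StatePartition 𝕏 M) (T : Kernel (𝕏 × 𝕌) 𝕏) (γ : Measure 𝕌) (π : Measure 𝕏)

theorem kappaPi_le (i : Fin M) (u : 𝕌) : kappaPi B γ π ≤ γ.real {u} * π.real (B.bin i) :=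
  ciInf_le (Set.finite_range _).bddBelow (i, u)

theorem kappaPi_pos [Nonempty 𝕌] [Nonempty (Fin M)] [IsProbabilityMeasure γ]
    [IsProbabilityMeasure π] (hγ : ∀ u, 0 < γ {u}) (hπ : ∀ i, 0 < π (B.bin i)) :
    0 < kappaPi B γ π := by
  obtain ⟨p, hp⟩ := exists_eq_ciInf_of_finite
    (f := fun p : Fin M × 𝕌 => γ.real {p.2} * π.real (B.bin p.1))
  rw [kappaPi, ← hp]
  exact mul_pos (ENNReal.toReal_pos (hγ _).ne' (measure_ne_top _ _))
    (ENNReal.toReal_pos (hπ _).ne' (measure_ne_top _ _))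

variable {B T π} in
-- There are finitely many entries, so the infimum is attained; a positive entry rules out the
-- default value `0` of the infimum of the empty set.
theorem kappaT_pos_and_le {i : Fin M} {u : 𝕌} {j : Fin M}
    (h : 0 < quantizedTransition B T π i u j) :
    0 < kappaT B T π ∧ kappaT B T π ≤ quantizedTransition B T π i u j := by
  have hfin : {r | ∃ i u j, r = quantizedTransition B T π i u j ∧
      0 < quantizedTransition B T π i u j}.Finite := by
    refine (Set.finite_range fun p : Fin M × 𝕌 × Fin M =>
      quantizedTransition B T π p.1 p.2.1 p.2.2).subset ?_
    rintro r ⟨i, u, j, rfl, -⟩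
    exact ⟨(i, u, j), rfl⟩
  constructor
  · obtain ⟨i', u', j', h1, h2⟩ := Set.Nonempty.csInf_mem (s := {r | ∃ i u j,
      r = quantizedTransition B T π i u j ∧ 0 < quantizedTransition B T π i u j})
      ⟨_, i, u, j, rfl, h⟩ hfin
    rw [kappaT, h1]
    exact h2
  · exact csInf_le hfin.bddBelow ⟨i, u, j, rfl, h⟩

end Kappa

/-! ### Stationary means over cells. -/

section Mean

variable {𝕏 𝕌 : Type*} [MeasurableSpace 𝕏] [MeasurableSpace 𝕌] {M : ℕ}
  (B : StatePartition 𝕏 M) {T : Kernel (𝕏 × 𝕌) 𝕏} [IsMarkovKernel T] {γ : Measure 𝕌}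
  {π ρ : Measure 𝕏} [IsProbabilityMeasure π] {ε : ℝ} (i : Fin M) (u : 𝕌)

omit [IsProbabilityMeasure π] in
theorem cellMean_one : cellMean B T γ π i u (fun _ _ => 1) = γ.real {u} * π.real (B.bin i) := by
  simp [cellMean]

omit [IsMarkovKernel T] in
theorem cellMean_indicator (hπ : π (B.bin i) ≠ 0) (j : Fin M) :
    cellMean B T γ π i u (fun _ y => (B.bin j).indicator 1 y) =
      γ.real {u} * π.real (B.bin i) * quantizedTransition B T π i u j := by
  have : π.real (B.bin i) ≠ 0 := (ENNReal.toReal_pos hπ (measure_ne_top _ _)).ne'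
  rw [quantizedTransition, mul_assoc, mul_div_cancel₀ _ this, cellMean]
  simp_rw [integral_indicator_one (B.measurableSet_bin j)]

theorem integrable_kernel_real {A : Set 𝕏} (hA : MeasurableSet A) :
    Integrable (fun x => (T (x, u)).real A) π :=
  integrable_of_abs_le (K := 1)
    (((T.measurable_coe hA).comp measurable_prodMk_right).ennreal_toReal) fun x => by
      rw [abs_of_nonneg measureReal_nonneg]
      exact measureReal_le_one

theorem Minorized.le_quantizedTransition (hm : Minorized T ρ ε) (hε : 0 ≤ ε)
    (hπ : π (B.bin i) ≠ 0) (j : Fin M) :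
    ε * ρ.real (B.bin j) ≤ quantizedTransition B T π i u j := by
  have hpos : 0 < π.real (B.bin i) := ENNReal.toReal_pos hπ (measure_ne_top _ _)
  rw [quantizedTransition, le_div_iff₀ hpos]
  have h1 : ∫ _ in B.bin i, ε * ρ.real (B.bin j) ∂π = ε * ρ.real (B.bin j) * π.real (B.bin i) := by
    simp [mul_comm]
  rw [← h1]
  refine integral_mono (integrable_const _)
    (integrable_kernel_real u (B.measurableSet_bin j)).integrableOn fun x => ?_
  have h2 := ENNReal.toReal_mono (measure_ne_top _ _) (hm x u _ (B.measurableSet_bin j))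
  rwa [ENNReal.toReal_mul, ENNReal.toReal_ofReal hε] at h2

theorem ae_kernel_eq_zero_of_quantizedTransition (hπ : π (B.bin i) ≠ 0) (j : Fin M)
    (h : quantizedTransition B T π i u j = 0) :
    ∀ᵐ x ∂π, x ∈ B.bin i → T (x, u) (B.bin j) = 0 := by
  have hpos : 0 < π.real (B.bin i) := ENNReal.toReal_pos hπ (measure_ne_top _ _)
  rw [quantizedTransition, div_eq_zero_iff, or_iff_left hpos.ne',
    integral_eq_zero_iff_of_nonneg (fun _ => measureReal_nonneg)
      (integrable_kernel_real u (B.measurableSet_bin j)).integrableOn] at h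
  have h' := (ae_restrict_iff' (B.measurableSet_bin i)).1 h
  filter_upwards [h'] with x hx hxi
  have := hx hxi
  simpa [Measure.real, ENNReal.toReal_eq_zero_iff] using this

omit [IsMarkovKernel T] [IsProbabilityMeasure π] in
theorem quantizedTransition_nonneg (j : Fin M) : 0 ≤ quantizedTransition B T π i u j :=
  div_nonneg (integral_nonneg fun _ => measureReal_nonneg) measureReal_nonneg

/-- The mean of a function over a cell, when its conditional mean is almost constant there. -/
theorem abs_cellMean_sub_le {ψ : 𝕏 → 𝕏 → ℝ} (hψ : Measurable (Function.uncurry ψ)) {K : ℝ}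
    (hK : ∀ x y, |ψ x y| ≤ K) {q s : ℝ}
    (h : ∀ x ∈ B.bin i, |∫ y, ψ x y ∂(T (x, u)) - q| ≤ s) :
    |cellMean B T γ π i u ψ - q * (γ.real {u} * π.real (B.bin i))| ≤
      γ.real {u} * π.real (B.bin i) * s := by
  have hm : Measurable fun x => ∫ y, ψ x y ∂(T (x, u)) :=
    (hψ.stronglyMeasurable.integral_kernel_prod_right
      (κ := T.comap (fun x => (x, u)) measurable_prodMk_right)).measurable
  have hint : Integrable (fun x => ∫ y, ψ x y ∂(T (x, u))) π :=
    integrable_of_abs_le hm fun x => abs_integral_le_of_abs_le (hK x)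
  have h1 : cellMean B T γ π i u ψ - q * (γ.real {u} * π.real (B.bin i)) =
      γ.real {u} * ∫ x in B.bin i, (∫ y, ψ x y ∂(T (x, u)) - q) ∂π := by
    rw [integral_sub hint.integrableOn (integrable_const _), setIntegral_const, cellMean,
      smul_eq_mul]
    ring
  rw [h1, abs_mul, abs_of_nonneg measureReal_nonneg, mul_assoc]
  refine mul_le_mul_of_nonneg_left ?_ measureReal_nonneg
  rw [mul_comm]
  exact norm_setIntegral_le_of_norm_le_const
    (f := fun x => ∫ y, ψ x y ∂(T (x, u)) - q) (measure_lt_top _ _) h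

omit [IsProbabilityMeasure π] in
-- A deviation below `kappaPi / 2` is less than half of any cell mean; in particular every cell is
-- visited.
theorem cellAvg_one_mem [Fintype 𝕌] {N : ℕ} {xs : ℕ → 𝕏} {us : ℕ → 𝕌} {B : StatePartition 𝕏 M}
    {i : Fin M} {u : 𝕌}
    (h : |cellAvg B N xs us i u (fun _ _ => 1) - cellMean B T γ π i u (fun _ _ => 1)| <
      kappaPi B γ π / 2) :
    γ.real {u} * π.real (B.bin i) / 2 ≤ cellAvg B N xs us i u (fun _ _ => 1) ∧
      cellAvg B N xs us i u (fun _ _ => 1) ≤ 3 / 2 * (γ.real {u} * π.real (B.bin i)) := by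
  rw [cellMean_one] at h
  have h1 := abs_lt.1 h
  have h2 := kappaPi_le B γ π i u
  constructor <;> linarith

end Mean

/-! ### Deterministic regret bound along a well-behaved trajectory. -/

section GoodPath

/-- Stability of a ratio: `a - q * b` splits into the fluctuation of `a`, the bias of its mean `m`,
and the fluctuation of `b`. Division by `b ≥ p / 2` doubles each, and only the fluctuations pay the
factor `1 / κ`. -/
theorem abs_div_sub_le {a b m p q s e κ K : ℝ} (hκ : 0 < κ) (hp : κ ≤ p) (hb : p / 2 ≤ b)
    (hK : 0 ≤ K) (he : 0 ≤ e) (hq : |q| ≤ K) (ha : |a - m| ≤ K * e) (hm : |m - q * p| ≤ p * s)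
    (hbp : |b - p| ≤ e) : |a / b - q| ≤ 4 * K * e / κ + 2 * s := by
  have hp0 : 0 < p := hκ.trans_le hp
  have hb0 : 0 < b := by linarith
  have h1 : |q * (b - p)| ≤ K * e := by
    rw [abs_mul]
    gcongr
  have h2 : |a - q * b| ≤ 2 * K * e + p * s := by
    have : a - q * b = (a - m) + (m - q * p) - q * (b - p) := by ring
    rw [this]
    exact (abs_sub _ _).trans (by linarith [abs_add_le (a - m) (m - q * p)])
  have h3 : 0 ≤ 2 * K * e + p * s := (abs_nonneg _).trans h2
  have h4 : a / b - q = (a - q * b) / b := by field_simp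
  rw [h4, abs_div, abs_of_pos hb0]
  calc |a - q * b| / b ≤ (2 * K * e + p * s) / (p / 2) := by gcongr
    _ = 4 * K * e / p + 2 * s := by field_simp; ring
    _ ≤ 4 * K * e / κ + 2 * s := by gcongr

variable {𝕏 𝕌 : Type*} [MetricSpace 𝕏] [SecondCountableTopology 𝕏] [MeasurableSpace 𝕏]
  [BorelSpace 𝕏] [Fintype 𝕌] [Nonempty 𝕌] [TopologicalSpace 𝕌] [DiscreteTopology 𝕌]
  [MeasurableSpace 𝕌] [BorelSpace 𝕌]
  {T : Kernel (𝕏 × 𝕌) 𝕏} [IsMarkovKernel T] {c : 𝕏 → 𝕌 → ℝ}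
  {ρ : Measure 𝕏} [IsProbabilityMeasure ρ] {γ : Measure 𝕌} [IsProbabilityMeasure γ]
  {π : Measure 𝕏} [IsProbabilityMeasure π] {M N : ℕ} {B : StatePartition 𝕏 M}
  {cSup ε δ e K : ℝ} {Lc LT L : ℝ≥0} {xs : ℕ → 𝕏} {us : ℕ → 𝕌}

/-- If the empirical cell frequencies are close to their means, an optimal policy of the empirical
model is nearly optimal. -/
theorem abs_regret_le_of_good_path
    (hr : WassersteinRegular c T cSup Lc LT) (hε : 0 < ε) (hm : Minorized T ρ ε)
    (hγ : ∀ u, 0 < γ {u}) (hinv : Kernel.Invariant (tripleKernel T γ) (tripleLaw T γ π))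
    (hπ : ∀ i, 0 < π (B.bin i)) (hN : 1 ≤ N)
    (hδ : ∀ i, ∀ x ∈ B.bin i, ∀ y ∈ B.bin i, dist x y ≤ δ)
    {h : 𝕏 → ℝ} (hL : LipschitzWith L h) (h0 : ∀ x, 0 ≤ h x) (hK : ∀ x u y, c x u + h y ≤ K)
    (hle : ∀ x u, ε / 2 * ∫ y, h y ∂ρ + h x ≤ c x u + ∫ y, h y ∂(T (x, u)))
    (heq : ∀ x, ∃ u, c x u + ∫ y, h y ∂(T (x, u)) = ε / 2 * ∫ y, h y ∂ρ + h x)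
    {hM : Fin M → ℝ} (hhM : ∀ i, ∃ x ∈ B.bin i, hM i = h x)
    (h1 : ∀ i u, |cellAvg B N xs us i u (fun _ _ => 1) - cellMean B T γ π i u (fun _ _ => 1)| <
      kappaPi B γ π / 2)
    (h2 : ∀ i u j, 0 < quantizedTransition B T π i u j →
      |cellAvg B N xs us i u (fun _ y => (B.bin j).indicator 1 y) -
        cellMean B T γ π i u (fun _ y => (B.bin j).indicator 1 y)| <
      kappaPi B γ π * kappaT B T π / 4)
    (h3 : ∀ i u, |cellAvg B N xs us i u (fun _ _ => 1) -
      cellMean B T γ π i u (fun _ _ => 1)| ≤ e)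
    (h4 : ∀ i u, |cellAvg B N xs us i u (fun x y => c x u + hM (B.index y)) -
      cellMean B T γ π i u (fun x y => c x u + hM (B.index y))| ≤ K * e)
    {f : Fin M → 𝕌} (hf : IsAvgOptimal (empCost B c N xs us) (empKernel B N xs us) f
      (measurable_of_finite f)) (x : 𝕏) :
    |avgCost c T (extendPolicy B f) x - optAvgCost c T x| ≤
      4 * (4 * K * e / kappaPi B γ π + 2 * ((Lc + L + L * LT) * δ) + 2 * (L * δ)) / (ε / 2) := by
  have : Nonempty (Fin M) := ⟨B.index x⟩
  set κ := kappaPi B γ π with hκdef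
  have hκ : 0 < κ := kappaPi_pos B γ π hγ hπ
  have hp0 : ∀ i u, 0 < γ.real {u} * π.real (B.bin i) := fun i u =>
    hκ.trans_le (kappaPi_le B γ π i u)
  have hmc : Measurable (Function.uncurry c) := hr.cost_continuous.measurable
  have hcS : 0 ≤ cSup := (hr.cost_nonneg x (Classical.arbitrary 𝕌)).trans (hr.cost_le _ _)
  have hcard : ∀ i u, (visits B N xs us i u).card ≠ 0 := by
    intro i u hv
    have := (cellAvg_one_mem (h1 i u)).1
    rw [cellAvg_one, hv] at this
    simp only [Nat.cast_zero, mul_zero] at this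
    linarith [hp0 i u]
  -- With cell mass `p` and entry `q`, the numerator is at least `3 / 4 * p * q` and the denominator
  -- at most `3 / 2 * p`.
  have hemp : ∀ i u j, 0 < quantizedTransition B T π i u j →
      quantizedTransition B T π i u j / 2 ≤ empTransition B N xs us i u j := by
    intro i u j hq
    obtain ⟨hT0, hTle⟩ := kappaT_pos_and_le hq
    have hb := cellAvg_one_mem (h1 i u)
    have hb0 : 0 < cellAvg B N xs us i u (fun _ _ => 1) := by linarith [hp0 i u]
    have ha := (abs_lt.1 (h2 i u j hq)).1
    rw [cellMean_indicator B i u (hπ i).ne' j] at ha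
    have hprod : κ * kappaT B T π ≤
        γ.real {u} * π.real (B.bin i) * quantizedTransition B T π i u j := by
      have := kappaPi_le B γ π i u
      gcongr
    rw [empTransition_eq_div B hN (hcard i u), le_div_iff₀ hb0]
    have := mul_le_mul_of_nonneg_left hb.2 hq.le
    linarith
  have hm' : Minorized (empKernel B N xs us) (ρ.map B.index) (ε / 2) := by
    refine minorized_of_singleton fun i u j => ?_
    have hpre : B.index ⁻¹' {j} = B.bin j := by
      ext y
      simpa using B.index_eq_iff y j
    rw [empKernel_singleton, Measure.map_apply B.measurable_index (measurableSet_singleton j), hpre,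
      ← ofReal_measureReal, ← ENNReal.ofReal_mul (by positivity)]
    refine ENNReal.ofReal_le_ofReal ?_
    have hq := hm.le_quantizedTransition B i u hε.le (hπ i).ne' j
    -- If the averaged entry vanishes, so does `ρ (B.bin j)`; otherwise half of the entry still
    -- dominates `ε / 2 * ρ`.
    rcases (quantizedTransition_nonneg B (T := T) (π := π) i u j).eq_or_lt with hq0 | hq0
    · have := empTransition_nonneg B N xs us i u j
      linarith
    · linarith [hemp i u j hq0]
  have hsupp : ∀ i u j, empKernel B N xs us (i, u) {j} = 0 →
      ∀ᵐ x ∂π, x ∈ B.bin i → T (x, u) (B.bin j) = 0 := by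
    intro i u j hz
    refine ae_kernel_eq_zero_of_quantizedTransition B i u (hπ i).ne' j ?_
    by_contra hne
    have hq0 := (quantizedTransition_nonneg B (T := T) (π := π) i u j).lt_of_ne' hne
    rw [empKernel_singleton, ENNReal.ofReal_eq_zero] at hz
    linarith [hemp i u j hq0]
  have hhK : ∀ y, |h y| ≤ K := fun y => by
    rw [abs_of_nonneg (h0 y)]
    linarith [hK x (Classical.arbitrary 𝕌) y, hr.cost_nonneg x (Classical.arbitrary 𝕌)]
  have hK0 : 0 ≤ K := (abs_nonneg _).trans (hhK x)
  have hδ₀ : ∀ y, |hM (B.index y) - h y| ≤ L * δ := by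
    intro y
    obtain ⟨z, hz, hzM⟩ := hhM (B.index y)
    rw [hzM]
    refine (hL.dist_le_mul z y).trans ?_
    gcongr
    exact hδ _ z hz y (B.mem_bin_index y)
  have hhMm : Measurable (fun y => hM (B.index y)) :=
    (measurable_of_finite hM).comp B.measurable_index
  have hhM0 : ∀ j, 0 ≤ hM j := fun j => by
    obtain ⟨z, -, hz⟩ := hhM j
    rw [hz]
    exact h0 z
  have hMK : ∀ x u j, c x u + hM j ≤ K := fun x u j => by
    obtain ⟨z, -, hz⟩ := hhM j
    rw [hz]
    exact hK x u z
  have he : 0 ≤ e := (abs_nonneg _).trans (h3 (B.index x) (Classical.arbitrary 𝕌))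
  refine abs_avgCost_extendPolicy_sub_le B (fun i => ?_) (by positivity) hmc hr.cost_nonneg
    hr.cost_le (fun i u => empCost_nonneg B hr.cost_nonneg)
    (fun i u => empCost_le B hcS hr.cost_le) (hm.mono (by linarith)) hm'
    hL.continuous.measurable hhK hle heq hδ₀ (fun y u => ?_)
    (absolutelyContinuous_of_invariant hε hm hinv)
    (fun E hE hE0 u => ae_kernel_eq_zero_of_invariant hγ hinv hE hE0 u) hsupp hf x
  · obtain ⟨z, hz, -⟩ := hhM i
    exact ⟨z, (B.index_eq_iff z i).2 hz⟩
  · rw [empCost_add_integral_eq_div B hN (hcard _ _)]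
    have hint : ∀ z, ∫ w, (c z u + hM (B.index w)) ∂(T (z, u)) =
        c z u + ∫ w, hM (B.index w) ∂(T (z, u)) := fun z => by
      rw [integral_add (integrable_const _) (integrable_of_abs_le hhMm (K := K) fun w => ?_)]
      · simp
      · rw [abs_of_nonneg (hhM0 _)]
        linarith [hMK z u (B.index w), hr.cost_nonneg z u]
    have hhint : ∀ z, Integrable h (T (z, u)) := fun z =>
      integrable_of_abs_le hL.continuous.measurable hhK
    have hMint : ∀ z, Integrable (fun w => hM (B.index w)) (T (z, u)) := fun z =>
      integrable_of_abs_le hhMm (K := K) fun w => by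
        rw [abs_of_nonneg (hhM0 _)]
        linarith [hMK z u (B.index w), hr.cost_nonneg z u]
    refine abs_div_sub_le hκ (kappaPi_le B γ π (B.index y) u) (cellAvg_one_mem (h1 _ _)).1 hK0 he
      ?_ (h4 _ _) (abs_cellMean_sub_le B _ u (K := K) ?_ (fun z w => ?_) fun z hz => ?_) ?_
    · have h5 : 0 ≤ ∫ w, h w ∂(T (y, u)) := integral_nonneg h0
      have h6 : ∫ w, h w ∂(T (y, u)) ≤ K - c y u := by
        have := integral_mono (hhint y) (integrable_const (K - c y u))
          fun w => (by linarith [hK y u w] : h w ≤ K - c y u)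
        simpa using this
      rw [abs_of_nonneg (by linarith [hr.cost_nonneg y u])]
      linarith
    · exact (hmc.comp (measurable_fst.prodMk measurable_const)).add (hhMm.comp measurable_snd)
    · rw [abs_of_nonneg (by linarith [hr.cost_nonneg z u, hhM0 (B.index w)])]
      exact hMK _ _ _
    -- Within a bin the cost varies by `Lc * δ` and the integral of `h` by `L * LT * δ`; replacing
    -- `h` by `hM` adds `L * δ`.
    · have hd : dist z y ≤ δ := hδ _ z hz y (B.mem_bin_index y)
      have h5 := (hr.cost_lipschitz u).dist_le_mul z y
      rw [Real.dist_eq] at h5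
      have h6 := hr.abs_integral_sub_le hL hhK u z y
      have h7 : |∫ w, (hM (B.index w) - h w) ∂(T (z, u))| ≤ L * δ :=
        abs_integral_le_of_abs_le hδ₀
      rw [integral_sub (hMint z) (hhint z)] at h7
      have h8 : (Lc : ℝ) * dist z y ≤ Lc * δ := by gcongr
      have h9 : (L : ℝ) * (LT * dist z y) ≤ L * (LT * δ) := by gcongr
      rw [hint]
      rw [abs_le] at *
      constructor <;> linarith
    · have := h3 (B.index y) u
      rwa [cellMean_one] at this

end GoodPath

/-! ### Expected maximum of sub-Gaussian variables and union bounds. -/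

section Maximal

/-- A discrete layer-cake bound: `⌊y / s⌋₊` counts the levels `(n + 1) * s` below `y`. -/
theorem ofReal_le_mul_one_add_tsum {y s : ℝ} (hs : 0 < s) :
    ENNReal.ofReal y ≤ ENNReal.ofReal s *
      (1 + ∑' n : ℕ, if ((n : ℝ) + 1) * s ≤ y then (1 : ℝ≥0∞) else 0) := by
  rcases le_total y 0 with hy | hy
  · simp [ENNReal.ofReal_of_nonpos hy]
  have h1 : ((⌊y / s⌋₊ : ℕ) : ℝ≥0∞) ≤
      ∑' n : ℕ, if ((n : ℝ) + 1) * s ≤ y then (1 : ℝ≥0∞) else 0 := by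
    refine le_trans ?_ (ENNReal.sum_le_tsum (Finset.range ⌊y / s⌋₊))
    rw [Finset.sum_congr rfl (g := fun _ => (1 : ℝ≥0∞)) fun n hn => ?_]
    · simp
    · rw [if_pos]
      have h2 : ((n + 1 : ℕ) : ℝ) ≤ y / s :=
        (Nat.le_floor_iff (by positivity)).1 (Finset.mem_range.1 hn)
      rw [le_div_iff₀ hs] at h2
      exact_mod_cast h2
  calc ENNReal.ofReal y ≤ ENNReal.ofReal (s * (1 + ⌊y / s⌋₊)) := by
        refine ENNReal.ofReal_le_ofReal ?_
        have := (Nat.lt_floor_add_one (y / s)).le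
        rw [div_le_iff₀ hs] at this
        linarith
    _ = ENNReal.ofReal s * (1 + (⌊y / s⌋₊ : ℕ)) := by
        rw [ENNReal.ofReal_mul hs.le, ENNReal.ofReal_add zero_le_one (by positivity)]
        simp
    _ ≤ _ := by gcongr

/-- With `k = n + 1 ≥ 1`, one has `1 - 2 * k ^ 2 ≤ -k`, so the left side is at most `m ^ (-k) ≤ 2 ^
(-k)`. -/
theorem mul_exp_neg_mul_log_le {m : ℝ} (hm : 2 ≤ m) (n : ℕ) :
    m * Real.exp (-(2 * ((n : ℝ) + 1) ^ 2 * Real.log m)) ≤ (1 / 2 : ℝ) ^ (n + 1) := by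
  have hm0 : 0 < m := by linarith
  have hlog : 0 ≤ Real.log m := Real.log_nonneg (by linarith)
  have h1 : m * Real.exp (-(2 * ((n : ℝ) + 1) ^ 2 * Real.log m)) =
      Real.exp (Real.log m - 2 * ((n : ℝ) + 1) ^ 2 * Real.log m) := by
    rw [sub_eq_add_neg, Real.exp_add, Real.exp_log hm0]
  have h2 : (1 / 2 : ℝ) ^ (n + 1) = Real.exp (-(((n : ℝ) + 1) * Real.log 2)) := by
    rw [one_div, inv_pow, Real.exp_neg, ← Nat.cast_succ, ← Real.log_pow, Real.exp_log (by positivity)]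
  rw [h1, h2, Real.exp_le_exp]
  have h3 : Real.log 2 ≤ Real.log m := Real.log_le_log two_pos hm
  have h4 : (0 : ℝ) ≤ n := n.cast_nonneg
  have h5 : ((n : ℝ) + 1) * Real.log 2 ≤ ((n : ℝ) + 1) * Real.log m := by gcongr
  have h6 : 0 ≤ (2 * ((n : ℝ) + 1) ^ 2 - 1 - (n + 1)) * Real.log m :=
    mul_nonneg (by nlinarith) hlog
  linarith

/-- The expected maximum of finitely many variables with sub-Gaussian tails. -/
theorem lintegral_iSup_ofReal_le {ι Ω : Type*} [Fintype ι] [MeasurableSpace Ω] {P : Measure Ω}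
    [IsProbabilityMeasure P] {Y : ι → Ω → ℝ} (hY : ∀ k, Measurable (Y k)) {C₀ c₀ : ℝ}
    (hC₀ : 0 < C₀) (hc₀ : 0 < c₀) {N : ℕ} (hN : 1 ≤ N)
    (htail : ∀ k η, 0 < η → P.real {ω | η ≤ Y k ω} ≤ C₀ * Real.exp (-(c₀ * N * η ^ 2)))
    {m : ℝ} (hm : 2 ≤ m) (hcard : (Fintype.card ι : ℝ) ≤ 2 * m) :
    ∫⁻ ω, ⨆ k, ENNReal.ofReal (Y k ω) ∂P ≤
      ENNReal.ofReal ((1 + 2 * C₀) * (√(2 / c₀) * √(Real.log m / N))) := by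
  have hN' : (0 : ℝ) < N := by exact_mod_cast hN
  have hlog : 0 < Real.log m := Real.log_pos (by linarith)
  -- This scale makes the tail at level `(n + 1) * s` equal to `C₀ * m ^ (-2 * (n + 1) ^ 2)`, which
  -- absorbs the union over at most `2 * m` variables and is summable in `n`.
  set s := √(2 / c₀) * √(Real.log m / N) with hs
  have hs0 : 0 < s := by positivity
  have hs2 : c₀ * N * s ^ 2 = 2 * Real.log m := by
    rw [hs, mul_pow, Real.sq_sqrt (by positivity), Real.sq_sqrt (by positivity)]
    field_simp
  have hmeas : ∀ (n : ℕ) k, MeasurableSet {ω | ((n : ℝ) + 1) * s ≤ Y k ω} := fun n k =>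
    measurableSet_le measurable_const (hY k)
  have hterm : ∀ n : ℕ, ∑ k, P {ω | ((n : ℝ) + 1) * s ≤ Y k ω} ≤
      ENNReal.ofReal (2 * C₀) * ENNReal.ofReal ((1 / 2 : ℝ) ^ (n + 1)) := by
    intro n
    have h1 : ∀ k, P {ω | ((n : ℝ) + 1) * s ≤ Y k ω} ≤
        ENNReal.ofReal (C₀ * Real.exp (-(2 * ((n : ℝ) + 1) ^ 2 * Real.log m))) := by
      intro k
      rw [← ofReal_measureReal]
      refine ENNReal.ofReal_le_ofReal ((htail k _ (by positivity)).trans (le_of_eq ?_))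
      rw [mul_pow, mul_left_comm, hs2]
      ring_nf
    refine (Finset.sum_le_sum fun k _ => h1 k).trans ?_
    rw [Finset.sum_const, nsmul_eq_mul, Finset.card_univ, ← ENNReal.ofReal_natCast,
      ← ENNReal.ofReal_mul (by positivity), ← ENNReal.ofReal_mul (by positivity)]
    refine ENNReal.ofReal_le_ofReal ?_
    have h2 := mul_exp_neg_mul_log_le hm n
    calc (Fintype.card ι : ℝ) * (C₀ * Real.exp (-(2 * ((n : ℝ) + 1) ^ 2 * Real.log m)))
        ≤ 2 * m * (C₀ * Real.exp (-(2 * ((n : ℝ) + 1) ^ 2 * Real.log m))) := by gcongr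
      _ = 2 * C₀ * (m * Real.exp (-(2 * ((n : ℝ) + 1) ^ 2 * Real.log m))) := by ring
      _ ≤ _ := by gcongr
  have hgeom : ∑' n : ℕ, ENNReal.ofReal ((1 / 2 : ℝ) ^ (n + 1)) = 1 := by
    rw [← ENNReal.ofReal_tsum_of_nonneg (fun n => by positivity)
      ((summable_nat_add_iff 1).2 summable_geometric_two)]
    simp_rw [pow_succ]
    rw [tsum_mul_right, tsum_geometric_two]
    norm_num
  calc ∫⁻ ω, ⨆ k, ENNReal.ofReal (Y k ω) ∂P
      ≤ ∫⁻ ω, ENNReal.ofReal s * (1 + ∑' n : ℕ, ∑ k,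
          {ω | ((n : ℝ) + 1) * s ≤ Y k ω}.indicator 1 ω) ∂P := by
        refine lintegral_mono fun ω => iSup_le fun k => ?_
        refine (ofReal_le_mul_one_add_tsum hs0).trans ?_
        gcongr with n
        refine le_trans (le_of_eq ?_) (Finset.single_le_sum (f := fun k =>
          {ω | ((n : ℝ) + 1) * s ≤ Y k ω}.indicator (1 : Ω → ℝ≥0∞) ω)
            (fun _ _ => zero_le) (Finset.mem_univ k))
        simp [Set.indicator_apply]
    _ = ENNReal.ofReal s * (1 + ∑' n : ℕ, ∑ k, P {ω | ((n : ℝ) + 1) * s ≤ Y k ω}) := by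
        have hm1 : ∀ n : ℕ, Measurable fun ω => ∑ k,
            {ω | ((n : ℝ) + 1) * s ≤ Y k ω}.indicator (1 : Ω → ℝ≥0∞) ω := fun n =>
          Finset.measurable_fun_sum _ fun k _ => measurable_one.indicator (hmeas n k)
        rw [lintegral_const_mul' _ _ (by simp), lintegral_add_left measurable_const,
          lintegral_tsum fun n => (hm1 n).aemeasurable]
        congr 2
        · simp
        · refine tsum_congr fun n => ?_
          rw [lintegral_finsetSum _ fun k _ => measurable_one.indicator (hmeas n k)]
          simp_rw [lintegral_indicator_one (hmeas n _)]
    _ ≤ ENNReal.ofReal s * (1 + ∑' n : ℕ,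
          ENNReal.ofReal (2 * C₀) * ENNReal.ofReal ((1 / 2 : ℝ) ^ (n + 1))) := by
        gcongr with n
        exact hterm n
    _ = ENNReal.ofReal ((1 + 2 * C₀) * s) := by
        rw [ENNReal.tsum_mul_left, hgeom, mul_one, ← ENNReal.ofReal_one,
          ← ENNReal.ofReal_add (by norm_num) (by positivity), ← ENNReal.ofReal_mul hs0.le, mul_comm]

theorem measure_iUnion_le_card_mul {ι Ω : Type*} [Fintype ι] [MeasurableSpace Ω] {P : Measure Ω}
    [IsFiniteMeasure P] {S : ι → Set Ω} {b : ℝ} (hb : ∀ k, P.real (S k) ≤ b) :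
    P (⋃ k, S k) ≤ ENNReal.ofReal (Fintype.card ι * b) := by
  refine (measure_iUnion_fintype_le P S).trans ?_
  refine (Finset.sum_le_sum fun k _ => ?_ : _ ≤ ∑ _k : ι, ENNReal.ofReal b).trans ?_
  · rw [← ofReal_measureReal]
    exact ENNReal.ofReal_le_ofReal (hb k)
  · rw [Finset.sum_const, nsmul_eq_mul, Finset.card_univ, ENNReal.ofReal_mul (by positivity),
      ENNReal.ofReal_natCast]

end Maximal

/-! ### Rescaling of cell averages and means. -/

section LearnedPolicy

theorem cellAvg_div {𝕏 𝕌 : Type*} [MeasurableSpace 𝕏] {M : ℕ} (B : StatePartition 𝕏 M)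
    (N : ℕ) (xs : ℕ → 𝕏) (us : ℕ → 𝕌) (i : Fin M) (u : 𝕌) (ψ : 𝕏 → 𝕏 → ℝ) (K : ℝ) :
    cellAvg B N xs us i u (fun x y => ψ x y / K) = cellAvg B N xs us i u ψ / K := by
  simp only [cellAvg, ← Finset.sum_div, mul_div_assoc]

variable {𝕏 𝕌 : Type*} [MeasurableSpace 𝕏] [MeasurableSpace 𝕌] {M : ℕ}

theorem cellMean_div (B : StatePartition 𝕏 M) (T : Kernel (𝕏 × 𝕌) 𝕏) (γ : Measure 𝕌)
    (π : Measure 𝕏) (i : Fin M) (u : 𝕌) (ψ : 𝕏 → 𝕏 → ℝ) (K : ℝ) :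
    cellMean B T γ π i u (fun x y => ψ x y / K) = cellMean B T γ π i u ψ / K := by
  simp only [cellMean, integral_div, mul_div_assoc]

end LearnedPolicy

/-! ### The expected regret: good paths, exceptional events, integration. -/

section Regret

variable {𝕏 𝕌 Ω : Type*} [MetricSpace 𝕏] [SecondCountableTopology 𝕏] [MeasurableSpace 𝕏]
  [BorelSpace 𝕏] [Fintype 𝕌] [Nonempty 𝕌] [TopologicalSpace 𝕌] [DiscreteTopology 𝕌]
  [MeasurableSpace 𝕌] [BorelSpace 𝕌] [MeasurableSpace Ω] {P : Measure Ω} [IsProbabilityMeasure P]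
  {T : Kernel (𝕏 × 𝕌) 𝕏} [IsMarkovKernel T] {c : 𝕏 → 𝕌 → ℝ}
  {ρ : Measure 𝕏} [IsProbabilityMeasure ρ] {γ : Measure 𝕌} [IsProbabilityMeasure γ]
  {π : Measure 𝕏} [IsProbabilityMeasure π] {X : ℕ → Ω → 𝕏} {U : ℕ → Ω → 𝕌}
  {M N : ℕ} {B : StatePartition 𝕏 M} {C₀ c₀ cSup ε δ : ℝ} {Lc LT L : ℝ≥0} {γhat : Ω → Fin M → 𝕌}

/-- The expected regret of the learned policy, with explicit constants. -/
theorem lintegral_regret_le (hC₀ : 0 < C₀) (hc₀ : 0 < c₀) (hε : 0 < ε) (hL : Lc + L * LT ≤ L)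
    (hr : WassersteinRegular c T cSup Lc LT) (hm : Minorized T ρ ε) (hγ : ∀ u, 0 < γ {u})
    (hX : ∀ n, Measurable (X n)) (hU : ∀ n, Measurable (U n))
    (he : ErgodicConcentration T γ π P X U C₀ c₀) (hπ : ∀ i, 0 < π (B.bin i)) (hN : 1 ≤ N)
    (hδ : ∀ i, ∀ x ∈ B.bin i, ∀ y ∈ B.bin i, dist x y ≤ δ)
    (hopt : ∀ ω, IsAvgOptimal (empCost B c N (fun n => X n ω) (fun n => U n ω))
      (empKernel B N (fun n => X n ω) (fun n => U n ω)) (γhat ω) (measurable_of_finite (γhat ω)))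
    (hMU : (2 : ℝ) ≤ M * Fintype.card 𝕌) :
    ∫⁻ ω, ⨆ x, ‖avgCost c T (extendPolicy B (γhat ω)) x - optAvgCost c T x‖ₑ ∂P ≤
      ENNReal.ofReal (|cSup| * (M * Fintype.card 𝕌 *
        (C₀ * Real.exp (-(c₀ * N * (kappaPi B γ π / 2) ^ 2))))) +
      ENNReal.ofReal (|cSup| * (M ^ 2 * Fintype.card 𝕌 *
        (C₀ * Real.exp (-(c₀ * N * (kappaPi B γ π * kappaT B T π / 4) ^ 2))))) +
      ENNReal.ofReal (16 * (Lc + 2 * L + L * LT) / ε * δ) +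
      ENNReal.ofReal (32 * (|cSup| + 2 * |cSup| / ε + 1) / ε / kappaPi B γ π *
        ((1 + 2 * C₀) * (√(2 / c₀) * √(Real.log (M * Fintype.card 𝕌) / N)))) := by
  obtain ⟨x₀⟩ := π.nonempty_of_neZero
  have : Nonempty (Fin M) := ⟨B.index x₀⟩
  have hcS : 0 ≤ cSup := (hr.cost_nonneg x₀ (Classical.arbitrary 𝕌)).trans (hr.cost_le _ _)
  have hmc : Measurable (Function.uncurry c) := hr.cost_continuous.measurable
  set κ := kappaPi B γ π with hκdef
  have hκ : 0 < κ := kappaPi_pos B γ π hγ hπ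
  -- `K` bounds `c + h`, since `h` is at most `cSup / (ε / 2)`; the extra `1` keeps it positive for
  -- a zero cost.
  set K := |cSup| + 2 * |cSup| / ε + 1 with hKdef
  have hK0 : 0 < K := by positivity
  -- The true equation is solved with `ε / 2`, the constant that the empirical model also inherits,
  -- so that the two solutions are normalized alike.
  obtain ⟨h, hrange, hle, heq, hclosed⟩ := exists_averageCost_solution (c := c) (T := T) (ρ := ρ)
    (K := cSup) (ε := ε / 2) (by positivity) hr.cost_nonneg hr.cost_le
    (fun u => hr.cost_continuous.comp (by fun_prop : Continuous fun x : 𝕏 => (x, u)))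
    (fun u v => (hr.kernel_continuous v).comp (by fun_prop : Continuous fun x : 𝕏 => (x, u)))
    (hm.mono (by linarith))
  have hLip : LipschitzWith L h := by
    refine hclosed {v | LipschitzWith L v} (isClosed_lipschitzWith L) ?_ fun v hv w hw => ?_
    · exact LipschitzWith.const' 0
    · have := hr.lipschitzWith_minorBellman (ρ := ρ) (ε := ε / 2) hL hv
      rwa [← funext hw] at this
  have hchK : ∀ x u y, c x u + h y ≤ K := by
    intro x u y
    have h1 := hr.cost_le x u
    have h2 := (hrange y).2
    rw [div_div_eq_mul_div, mul_comm cSup] at h2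
    rw [hKdef, abs_of_nonneg hcS]
    linarith
  choose rep hrep using fun i => nonempty_of_measure_ne_zero (hπ i).ne'
  let hM : Fin M → ℝ := fun i => h (rep i)
  let ψ : 𝕌 → 𝕏 → 𝕏 → ℝ := fun u x y => c x u + hM (B.index y)
  have hψm : ∀ u, Measurable (Function.uncurry (ψ u)) := fun u =>
    (hmc.comp (measurable_fst.prodMk measurable_const)).add
      (((measurable_of_finite hM).comp B.measurable_index).comp measurable_snd)
  have hψ0 : ∀ u x y, 0 ≤ ψ u x y := fun u x y => add_nonneg (hr.cost_nonneg x u) (hrange _).1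
  have hψK : ∀ u x y, ψ u x y ≤ K := fun u x y => hchK x u _
  -- deviations of the cell averages
  let dev : (ψ : 𝕏 → 𝕏 → ℝ) → Fin M → 𝕌 → Ω → ℝ := fun ψ i u ω =>
    |cellAvg B N (fun n => X n ω) (fun n => U n ω) i u ψ - cellMean B T γ π i u ψ|
  have hdevm : ∀ ψ : 𝕏 → 𝕏 → ℝ, Measurable (Function.uncurry ψ) → ∀ i u,
      Measurable (dev ψ i u) := fun ψ hψ i u =>
    ((measurable_cellAvg B i u hX hU hψ N).sub measurable_const).abs
  have hone : Measurable (Function.uncurry (fun _ _ : 𝕏 => (1 : ℝ))) := measurable_const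
  have hind : ∀ j, Measurable (Function.uncurry
      (fun _ y : 𝕏 => (B.bin j).indicator (1 : 𝕏 → ℝ) y)) := fun j =>
    (measurable_one.indicator (B.measurableSet_bin j)).comp measurable_snd
  have hψKm : ∀ u, Measurable (Function.uncurry (fun x y => ψ u x y / K)) := fun u =>
    (hψm u).div_const K
  -- Visit frequencies and Bellman numerators, the latter divided by `K` to take values in `[0, 1]`.
  -- No index for the next bin occurs, whence `log (M |𝕌|)`.
  let Y : (Fin M × 𝕌) ⊕ (Fin M × 𝕌) → Ω → ℝ := Sum.elim (fun p => dev (fun _ _ => 1) p.1 p.2)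
    (fun p => dev (fun x y => ψ p.2 x y / K) p.1 p.2)
  have hYm : ∀ k, Measurable (Y k) := by
    rintro (p | p)
    · exact hdevm _ hone _ _
    · exact hdevm _ (hψKm p.2) _ _
  have hYtail : ∀ k η, 0 < η → P.real {ω | η ≤ Y k ω} ≤
      C₀ * Real.exp (-(c₀ * N * η ^ 2)) := by
    rintro (p | p) η hη
    · exact he.cellAvg B _ _ hone (fun _ _ => zero_le_one) (fun _ _ => le_rfl) hη hN
    · exact he.cellAvg B _ _ (hψKm p.2) (fun _ _ => div_nonneg (hψ0 _ _ _) hK0.le)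
        (fun _ _ => (div_le_one hK0).2 (hψK _ _ _)) hη hN
  have hmax := lintegral_iSup_ofReal_le (P := P) hYm hC₀ hc₀ hN hYtail hMU (by
    simp only [Fintype.card_sum, Fintype.card_prod, Fintype.card_fin]
    push_cast
    linarith)
  -- the exceptional events
  let S₁ : Fin M × 𝕌 → Set Ω := fun p => {ω | κ / 2 ≤ dev (fun _ _ => 1) p.1 p.2 ω}
  let S₂ : Fin M × 𝕌 × Fin M → Set Ω := fun p =>
    {ω | 0 < quantizedTransition B T π p.1 p.2.1 p.2.2 ∧ κ * kappaT B T π / 4 ≤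
      dev (fun _ y => (B.bin p.2.2).indicator 1 y) p.1 p.2.1 ω}
  have hS₁m : MeasurableSet (⋃ p, S₁ p) := MeasurableSet.iUnion fun p =>
    measurableSet_le measurable_const (hdevm _ hone _ _)
  have hS₂m : MeasurableSet (⋃ p, S₂ p) := MeasurableSet.iUnion fun p =>
    (MeasurableSet.const _).inter (measurableSet_le measurable_const (hdevm _ (hind _) _ _))
  have hS₁ : P (⋃ p, S₁ p) ≤ ENNReal.ofReal (M * Fintype.card 𝕌 *
      (C₀ * Real.exp (-(c₀ * N * (κ / 2) ^ 2)))) := by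
    refine (measure_iUnion_le_card_mul fun p => he.cellAvg B _ _ hone (fun _ _ => zero_le_one)
      (fun _ _ => le_rfl) (by positivity) hN).trans (le_of_eq ?_)
    simp
  have hS₂ : P (⋃ p, S₂ p) ≤ ENNReal.ofReal (M ^ 2 * Fintype.card 𝕌 *
      (C₀ * Real.exp (-(c₀ * N * (κ * kappaT B T π / 4) ^ 2)))) := by
    refine (measure_iUnion_le_card_mul (b := C₀ * Real.exp (-(c₀ * N *
      (κ * kappaT B T π / 4) ^ 2))) fun p => ?_).trans (le_of_eq ?_)
    · by_cases hq : 0 < quantizedTransition B T π p.1 p.2.1 p.2.2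
      · have hT := (kappaT_pos_and_le hq).1
        refine (measureReal_mono fun ω hω => hω.2).trans (he.cellAvg B _ _ (hind p.2.2)
          (fun _ _ => Set.indicator_nonneg (fun _ _ => zero_le_one) _)
          (fun _ _ => Set.indicator_le_self' (fun _ _ => zero_le_one) _) (by positivity) hN)
      · have : S₂ p = ∅ := Set.eq_empty_of_forall_notMem fun ω hω => hq hω.1
        rw [this, measureReal_empty]
        positivity
    · simp only [Fintype.card_prod, Fintype.card_fin]
      push_cast
      ring_nf
  have hcost : ∀ x u, |c x u| ≤ cSup := fun x u => by
    rw [abs_of_nonneg (hr.cost_nonneg x u)]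
    exact hr.cost_le x u
  -- The regret is at most `cSup` on the exceptional events. The majorant is measurable, so
  -- integrating it requires no measurability of the supremum over `x`.
  have hbound : ∀ ω, (⨆ x, ‖avgCost c T (extendPolicy B (γhat ω)) x - optAvgCost c T x‖ₑ) ≤
      (⋃ p, S₁ p).indicator (fun _ => ENNReal.ofReal |cSup|) ω +
      (⋃ p, S₂ p).indicator (fun _ => ENNReal.ofReal |cSup|) ω +
      ENNReal.ofReal (16 * (Lc + 2 * L + L * LT) / ε * δ) +
      ENNReal.ofReal (32 * K / ε / κ) * ⨆ k, ENNReal.ofReal (Y k ω) := by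
    intro ω
    refine iSup_le fun x => ?_
    rw [← ofReal_norm, Real.norm_eq_abs]
    by_cases hbad : ω ∈ (⋃ p, S₁ p) ∪ ⋃ p, S₂ p
    · have h1 : |avgCost c T (extendPolicy B (γhat ω)) x - optAvgCost c T x| ≤ |cSup| := by
        have h2 := optAvgCost_le (T := T) hcost hr.cost_nonneg (extendPolicy B (γhat ω)) x
        have h3 := avgCost_le_bound (T := T) hcost (extendPolicy B (γhat ω)) x
        have h4 : 0 ≤ optAvgCost c T x :=
          Real.iInf_nonneg fun γ' => avgCost_nonneg hcost hr.cost_nonneg γ' x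
        rw [abs_of_nonneg (by linarith)]
        linarith
      refine (ENNReal.ofReal_le_ofReal h1).trans ?_
      rcases hbad with hb | hb
      · rw [Set.indicator_of_mem hb]
        simp only [add_assoc]
        exact le_self_add
      · rw [Set.indicator_of_mem hb, add_comm (Set.indicator _ _ _)]
        simp only [add_assoc]
        exact le_self_add
    · rw [Set.mem_union, not_or] at hbad
      obtain ⟨k, hk⟩ := Finite.exists_max (fun k => Y k ω)
      have hY0 : 0 ≤ Y k ω :=
        (abs_nonneg _).trans (hk (Sum.inl (Classical.arbitrary _, Classical.arbitrary _)))
      have hreg := abs_regret_le_of_good_path (xs := fun n => X n ω) (us := fun n => U n ω)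
        (e := Y k ω) (K := K) (hM := hM) hr hε hm hγ he.invariant hπ hN hδ hLip
        (fun x => (hrange x).1) hchK hle heq (fun i => ⟨rep i, hrep i, rfl⟩)
        (fun i u => not_le.1 fun hb => hbad.1 (Set.mem_iUnion.2 ⟨(i, u), hb⟩))
        (fun i u j hq => not_le.1 fun hb => hbad.2 (Set.mem_iUnion.2 ⟨(i, u, j), hq, hb⟩))
        (fun i u => hk (Sum.inl (i, u)))
        (fun i u => by
          have h1 := hk (Sum.inr (i, u))
          simp only [Y, dev, Sum.elim_inr] at h1
          rw [cellAvg_div, cellMean_div, ← sub_div, abs_div, abs_of_pos hK0,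
            div_le_iff₀ hK0] at h1
          rw [mul_comm]
          exact h1) (hopt ω) x
      have hval : 4 * (4 * K * Y k ω / κ + 2 * ((Lc + L + L * LT) * δ) + 2 * (L * δ)) / (ε / 2) =
          16 * (Lc + 2 * L + L * LT) / ε * δ + 32 * K / ε / κ * Y k ω := by
        field_simp
        ring
      rw [hval] at hreg
      refine (ENNReal.ofReal_le_ofReal hreg).trans (ENNReal.ofReal_add_le.trans ?_)
      rw [ENNReal.ofReal_mul (by positivity : 0 ≤ 32 * K / ε / κ)]
      refine add_le_add le_add_self ?_
      gcongr
      exact le_iSup (fun k => ENNReal.ofReal (Y k ω)) k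
  refine (lintegral_mono hbound).trans ?_
  have hmeasY : Measurable fun ω =>
      ENNReal.ofReal (32 * K / ε / κ) * ⨆ k, ENNReal.ofReal (Y k ω) :=
    (Measurable.iSup fun k => (hYm k).ennreal_ofReal).const_mul _
  rw [lintegral_add_right _ hmeasY, lintegral_add_right _ measurable_const,
    lintegral_add_right _ (measurable_const.indicator hS₂m), lintegral_const_mul' _ _ (by simp),
    lintegral_indicator_const hS₁m, lintegral_indicator_const hS₂m, lintegral_const, measure_univ,
    mul_one, ENNReal.ofReal_mul (abs_nonneg cSup), ENNReal.ofReal_mul (abs_nonneg cSup),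
    ENNReal.ofReal_mul (by positivity : 0 ≤ 32 * K / ε / κ)]
  gcongr

omit [SecondCountableTopology 𝕏] [BorelSpace 𝕏] in
theorem StatePartition.dist_le_mesh (B : StatePartition 𝕏 M) (hB : B.mesh ≠ ⊤) {i : Fin M}
    {x y : 𝕏} (hx : x ∈ B.bin i) (hy : y ∈ B.bin i) : dist x y ≤ B.mesh.toReal := by
  rw [dist_edist]
  exact ENNReal.toReal_mono hB ((Metric.edist_le_ediam_of_mem hx hy).trans
    (le_iSup (fun i => Metric.ediam (B.bin i)) i))

end Regret

end MDP

/-! ### Choice of the constant and the degenerate cases. -/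

theorem mainTheorem7 (C₀ c₀ cSup ε : ℝ) (Lc LT : ℝ≥0)
    (hC₀ : 0 < C₀) (hc₀ : 0 < c₀) (hε : 0 < ε) (hLT : LT < 1) :
    ∃ C : ℝ, 0 < C ∧
      ∀ (𝕏 : Type*) [MetricSpace 𝕏] [CompleteSpace 𝕏] [SecondCountableTopology 𝕏]
        [MeasurableSpace 𝕏] [BorelSpace 𝕏]
        (𝕌 : Type*) [Fintype 𝕌] [Nonempty 𝕌] [TopologicalSpace 𝕌] [DiscreteTopology 𝕌]
        [MeasurableSpace 𝕌] [BorelSpace 𝕌]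
        (Ω : Type*) [MeasurableSpace Ω] (P : Measure Ω) [IsProbabilityMeasure P]
        (T : Kernel (𝕏 × 𝕌) 𝕏) [IsMarkovKernel T] (c : 𝕏 → 𝕌 → ℝ)
        (ρ : Measure 𝕏) [IsProbabilityMeasure ρ]
        (γ : Measure 𝕌) [IsProbabilityMeasure γ]
        (π : Measure 𝕏) [IsProbabilityMeasure π]
        (X : ℕ → Ω → 𝕏) (U : ℕ → Ω → 𝕌)
        (M : ℕ) (B : MDP.StatePartition 𝕏 M) (N : ℕ) (γhat : Ω → Fin M → 𝕌),
        MDP.WassersteinRegular c T cSup Lc LT →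
        MDP.Minorized T ρ ε →
        (∀ u, 0 < γ {u}) →
        MDP.IsExplorationChain T γ P X U →
        MDP.ErgodicConcentration T γ π P X U C₀ c₀ →
        (∀ i, 0 < π (B.bin i)) →
        1 ≤ N →
        Measurable γhat →
        (∀ ω, MDP.IsAvgOptimal
          (MDP.empCost B c N (fun n => X n ω) (fun n => U n ω))
          (MDP.empKernel B N (fun n => X n ω) (fun n => U n ω))
          (γhat ω) (measurable_of_finite (γhat ω))) →
        ∫⁻ ω, ⨆ x, ‖MDP.avgCost c T (MDP.extendPolicy B (γhat ω)) x - MDP.optAvgCost c T x‖ₑ ∂P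
          ≤ ENNReal.ofReal C * (B.mesh + ENNReal.ofReal
              ((MDP.kappaPi B γ π)⁻¹ * √(Real.log (M * Fintype.card 𝕌) / N)))
            + ENNReal.ofReal (C * M * Fintype.card 𝕌 *
                Real.exp (-(C⁻¹ * MDP.kappaPi B γ π ^ 2 * N)))
            + ENNReal.ofReal (C * M ^ 2 * Fintype.card 𝕌 *
                Real.exp (-(C⁻¹ * MDP.kappaPi B γ π ^ 2 * MDP.kappaT B T π ^ 2 * N))) := by
  have hLT' : (0 : ℝ) < 1 - LT := by simpa using hLT
  -- The solution of `Lc + L * LT = L`, the Lipschitz constant preserved by the Bellman operator.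
  set L : ℝ≥0 := Lc / (1 - LT) with hLdef
  have hL : Lc + L * LT ≤ L := by
    rw [← NNReal.coe_le_coe]
    push_cast [hLdef, NNReal.coe_sub hLT.le]
    exact le_of_eq (by field_simp; ring)
  set A : ℝ := 16 * (Lc + 2 * L + L * LT) / ε
  set Q : ℝ := 32 * (|cSup| + 2 * |cSup| / ε + 1) / ε * ((1 + 2 * C₀) * √(2 / c₀))
  have hA : 0 ≤ A := by positivity
  have hQ : 0 ≤ Q := by positivity
  -- The summand `16 / c₀` gives `C⁻¹ ≤ c₀ / 16`, as required by the squared threshold factor `1 /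
  -- 4` in the second exponent; the other summands dominate the prefactors.
  refine ⟨A + Q + |cSup| * C₀ + 16 / c₀ + 1, by positivity, ?_⟩
  intro 𝕏 _ _ _ _ _ 𝕌 _ _ _ _ _ _ Ω _ P _ T _ c ρ _ γ _ π _ X U M B N γhat hr hm hγ hX he hπ hN
    _ hopt
  set C : ℝ := A + Q + |cSup| * C₀ + 16 / c₀ + 1 with hC
  have hc₀C : 0 < 16 / c₀ := by positivity
  have hSC : 0 ≤ |cSup| * C₀ := by positivity
  have hC0 : 0 < C := by positivity
  have hCinv : C⁻¹ ≤ c₀ / 16 := by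
    rw [inv_le_comm₀ hC0 (by positivity), inv_div]
    linarith
  rcases Nat.lt_or_ge 1 (M * Fintype.card 𝕌) with hMU | hMU
  swap
  -- Here there is one bin and one action, the logarithm vanishes, and the regret is zero because no
  -- choice is available.
  · obtain ⟨x₀⟩ := π.nonempty_of_neZero
    have hM : 1 ≤ M := (B.index x₀).pos
    have : Subsingleton 𝕌 := Fintype.card_le_one_iff_subsingleton.1 (by nlinarith)
    simp [MDP.avgCost_eq_optAvgCost_of_subsingleton]
  by_cases hB : B.mesh = ⊤
  · rw [hB, top_add, ENNReal.mul_top (by simpa using hC0), top_add, top_add]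
    exact le_top
  have hN' : (0 : ℝ) < N := by exact_mod_cast hN
  have hmain := MDP.lintegral_regret_le (L := L) hC₀ hc₀ hε hL hr hm hγ hX.measurable_state
    hX.measurable_action he hπ hN (fun i x hx y hy => B.dist_le_mesh hB hx hy) hopt
    (by exact_mod_cast hMU)
  refine hmain.trans ?_
  set κ := MDP.kappaPi B γ π
  set τ := MDP.kappaT B T π
  set r := √(Real.log (M * Fintype.card 𝕌) / N)
  have hκ : 0 ≤ κ := Real.iInf_nonneg fun p => mul_nonneg measureReal_nonneg measureReal_nonneg
  have e1 : |cSup| * (M * Fintype.card 𝕌 * (C₀ * Real.exp (-(c₀ * N * (κ / 2) ^ 2)))) ≤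
      C * M * Fintype.card 𝕌 * Real.exp (-(C⁻¹ * κ ^ 2 * N)) := by
    have h1 : C⁻¹ * κ ^ 2 * N ≤ c₀ * N * (κ / 2) ^ 2 := by
      have : C⁻¹ * (κ ^ 2 * N) ≤ c₀ / 16 * (κ ^ 2 * N) := by gcongr
      have h0 : 0 ≤ c₀ * (κ ^ 2 * N) := by positivity
      nlinarith
    calc _ = |cSup| * C₀ * M * Fintype.card 𝕌 * Real.exp (-(c₀ * N * (κ / 2) ^ 2)) := by ring
      _ ≤ _ := by gcongr; linarith
  have e2 : |cSup| * (M ^ 2 * Fintype.card 𝕌 * (C₀ * Real.exp (-(c₀ * N * (κ * τ / 4) ^ 2)))) ≤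
      C * M ^ 2 * Fintype.card 𝕌 * Real.exp (-(C⁻¹ * κ ^ 2 * τ ^ 2 * N)) := by
    have h1 : C⁻¹ * κ ^ 2 * τ ^ 2 * N ≤ c₀ * N * (κ * τ / 4) ^ 2 := by
      have : C⁻¹ * (κ ^ 2 * τ ^ 2 * N) ≤ c₀ / 16 * (κ ^ 2 * τ ^ 2 * N) := by gcongr
      linarith
    calc _ = |cSup| * C₀ * M ^ 2 * Fintype.card 𝕌 * Real.exp (-(c₀ * N * (κ * τ / 4) ^ 2)) := by
          ring
      _ ≤ _ := by gcongr; linarith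
  have e3 : ENNReal.ofReal (A * B.mesh.toReal) ≤ ENNReal.ofReal C * B.mesh := by
    rw [ENNReal.ofReal_mul hA, ENNReal.ofReal_toReal hB]
    gcongr
    linarith
  have e4 : ENNReal.ofReal (32 * (|cSup| + 2 * |cSup| / ε + 1) / ε / κ *
      ((1 + 2 * C₀) * (√(2 / c₀) * r))) ≤ ENNReal.ofReal C * ENNReal.ofReal (κ⁻¹ * r) := by
    rw [← ENNReal.ofReal_mul hC0.le]
    refine ENNReal.ofReal_le_ofReal ?_
    calc _ = Q * (κ⁻¹ * r) := by ring
      _ ≤ C * (κ⁻¹ * r) := by gcongr; linarith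
  rw [mul_add (ENNReal.ofReal C)]
  refine (add_le_add (add_le_add (add_le_add (ENNReal.ofReal_le_ofReal e1)
    (ENNReal.ofReal_le_ofReal e2)) e3) e4).trans (le_of_eq ?_)
  ring
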